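/- **Model.** Fix a number $I$ of job types and service rates $\mu_1,\dots,\mu_I>0$. For each $n\in\mathbb N$ consider a system with $n$ identical servers, in which type-$i$ jobs arrive according to independent Poisson processes of rates $\lambda_i=\lambda_i^{(n)}\ge 0$, each type-$i$ job needs $\ell_i=\ell_i^{(n)}\in\{1,2,\dots\}$ servers simultaneously while in service, and service times of type-$i$ jobs are independent exponential with rate $\mu_i$. A scheduling policy decides at every time which of the present jobs are in service; it may be preemptive (preempted work is resumed), randomized and history-dependent, but it does not know future arrivals or remaining service times. Thus, if $X_i(t)$ and $Z_i(t)$ are the numbers of type-$i$ jobs in the system and in service, then $Z_i(t)\le X_i(t)$, $\sum_i \ell_i Z_i(t)\le n$, and, given the past, type-$i$ departures occur at rate $\mu_i Z_i(t)$. Let $Q_i=X_i-Z_i$. When $(X(t),Z(t))$ has a steady-state distribution (a probability law that gives the long-run time-averaged probability of every state; in particular the law of a stationary process, or a limiting law), let $(X(\infty),Z(\infty))$ have that law and $Q_i(\infty)=X_i(\infty)-Z_i(\infty)$. Put $$\delta=\delta^{(n)}=n-\sum_{i=1}^I\frac{\lambda_i\ell_i}{\mu_i},\qquad \sigma^2=(\sigma^2)^{(n)}=\sum_{i=1}^I\frac{\lambda_i\ell_i^2}{\mu_i^2},\qquad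 \ell_{\max}=\max_{i}\ell_i .$$ **Lemma (workload lower bound).** Assume that $\delta=o\!\left(\sqrt{\sigma^2}/\log n\right)$ as $n\to\infty$, and that there is a constant $\epsilon_0\in(0,1)$ such that $\ell_{\max}\le\epsilon_0\,\delta$ for all sufficiently large $n$. Then there is a sequence $\varepsilon_n\to0$, depending on the sequence of system parameters but not on the policies, such that for every $n$, under every scheduling policy for the $n$-server system and for every steady-state distribution under it, $$\mathbb E\left[\sum_{i=1}^I\frac{\ell_i}{\mu_i}\,Q_i(\infty)\right]\ \ge\ \frac{\sigma^2}{\delta}\,(1-\varepsilon_n),$$ where the expectation may be $+\infty$ (for the finitely many $n$ with $\delta=0$, if any, the right-hand side is read as $0$). -/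

import Mathlib

open MeasureTheory ProbabilityTheory Filter Topology Asymptotics
open scoped NNReal ENNReal

noncomputable section

namespace MultiserverJob

variable {I : ℕ}

/-- Slack capacity `δ = n - ∑ᵢ λᵢ ℓᵢ / μᵢ` of a system with `n` servers, arrival rates `lam`,
server needs `ell` and service rates `mu`. -/
def slack (n : ℕ) (lam : Fin I → ℝ≥0) (ell : Fin I → ℕ) (mu : Fin I → ℝ) : ℝ :=
  n - ∑ i, (lam i : ℝ) * ell i / mu i

/-- Work variability `σ² = ∑ᵢ λᵢ ℓᵢ² / μᵢ²`. -/
def workVar (lam : Fin I → ℝ≥0) (ell : Fin I → ℕ) (mu : Fin I → ℝ) : ℝ :=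
  ∑ i, (lam i : ℝ) * (ell i : ℝ) ^ 2 / mu i ^ 2

/-- Maximal server need `ℓ_max = maxᵢ ℓᵢ`. -/
def maxNeed (ell : Fin I → ℕ) : ℕ :=
  Finset.univ.sup ell

/-- A counting path: it starts at `0`, is nondecreasing and right-continuous, and has only jumps
of size one (for a nondecreasing `ℕ`-valued path, right-continuity at `t` means that it is constant
on some `[t, u]` with `u > t`, and a jump of size at most one at `t` means `N t ≤ N s + 1` for
some, equivalently for all large enough, `s < t`). -/
structure IsCountingPath (N : ℝ≥0 → ℕ) : Prop where
  zero : N 0 = 0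
  mono : Monotone N
  rightCont : ∀ t, ∃ u, t < u ∧ N u = N t
  unitJump : ∀ t, 0 < t → ∃ s, s < t ∧ N t ≤ N s + 1

/-- `IsProcess n lam ell mu P ℱ X Z A D`: the processes describe a multiserver-job system with `n`
servers and `I` job types, run under some scheduling policy.  Here `X t ω i` is the number of
type-`i` jobs in the system at time `t`, `Z t ω i` the number of those in service, and `A t ω i`,
`D t ω i` count the type-`i` arrivals and departures during `(0, t]`.

The filtration `ℱ` is the information available to the policy.  The policy enters only through the
choice of `Z`, which is an arbitrary progressively measurable process subject to the capacity
constraint; hence policies may be preemptive, randomized, and may depend on the whole history (they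
need not be Markovian or work-conserving), but they do not see the future arrivals or the remaining
service times. -/
structure IsProcess (n : ℕ) (lam : Fin I → ℝ≥0) (ell : Fin I → ℕ) (mu : Fin I → ℝ)
    {Ω : Type*} {mΩ : MeasurableSpace Ω} (P : Measure Ω) (ℱ : Filtration ℝ≥0 mΩ)
    (X Z A D : ℝ≥0 → Ω → Fin I → ℕ) : Prop where
  adapted_X : Adapted ℱ X
  adapted_A : Adapted ℱ A
  adapted_D : Adapted ℱ D
  /-- The scheduling decision depends on the available information only. -/
  progressive_Z : IsStronglyProgressive ℱ Z
  /-- At most `n` servers are busy. -/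
  capacity : ∀ᵐ ω ∂P, ∀ t, ∑ i, ell i * Z t ω i ≤ n
  /-- Only jobs that are present can be in service. -/
  service_le : ∀ᵐ ω ∂P, ∀ t i, Z t ω i ≤ X t ω i
  /-- `X = X(0) + arrivals - departures`. -/
  balance : ∀ᵐ ω ∂P, ∀ t i, X t ω i + D t ω i = X 0 ω i + A t ω i
  /-- Arrivals and departures of each type are counted by nondecreasing paths. -/
  mono_A : ∀ᵐ ω ∂P, ∀ i, Monotone fun t => A t ω i
  mono_D : ∀ᵐ ω ∂P, ∀ i, Monotone fun t => D t ω i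
  /-- Arrivals and departures occur one at a time. -/
  simple : ∀ᵐ ω ∂P, IsCountingPath fun t => ∑ i, (A t ω i + D t ω i)
  /-- Type-`i` jobs arrive according to a Poisson process of rate `λᵢ`, ... -/
  poisson : ∀ i s t, s ≤ t →
    HasLaw (fun ω => A t ω i - A s ω i) (poissonMeasure (lam i * (t - s))) P
  /-- ... the processes of the different types are independent, ... -/
  indep_types : ∀ s t, s ≤ t → iIndepFun (fun i ω => A t ω i - A s ω i) P
  /-- ... and future arrivals are independent of the past. -/
  indep_past : ∀ s t, s ≤ t →
    Indep (MeasurableSpace.comap (fun ω i => A t ω i - A s ω i) inferInstance) (ℱ s) P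
  /-- Service times of type-`i` jobs are exponential of rate `μᵢ`: given the past, each of the
  `Zᵢ(t)` type-`i` jobs in service at time `t` completes at rate `μᵢ`, that is, the departure
  counting process has stochastic intensity `μᵢ Zᵢ(t)` with respect to `ℱ`. -/
  departure_intensity : ∀ i, Martingale
    (fun (t : ℝ≥0) ω => (D t ω i : ℝ) - mu i * ∫ s in (0 : ℝ)..t, (Z s.toNNReal ω i : ℝ)) ℱ P

/-- `π` is a steady-state distribution of `(X, Z)`: a probability law on pairs `(x, z)` that gives
the long-run fraction of time spent in each state.  This is the case for the common law of
`(X(t), Z(t))` if the pair is stationary, and for the limiting law of `(X(t), Z(t))` as `t → ∞`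
if there is one. -/
structure IsSteadyState {Ω : Type*} {mΩ : MeasurableSpace Ω} (P : Measure Ω)
    (X Z : ℝ≥0 → Ω → Fin I → ℕ) (π : Measure ((Fin I → ℕ) × (Fin I → ℕ))) : Prop where
  prob : IsProbabilityMeasure π
  average : ∀ x z, Tendsto
    (fun T : ℝ => T⁻¹ * ∫ t in (0 : ℝ)..T,
      P.real {ω | X t.toNNReal ω = x ∧ Z t.toNNReal ω = z})
    atTop (𝓝 (π.real {(x, z)}))

/-- The workload `∑ᵢ (ℓᵢ / μᵢ) Qᵢ` with `Qᵢ = xᵢ - zᵢ` the number of type-`i` jobs in queue. -/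
def workload (ell : Fin I → ℕ) (mu : Fin I → ℝ) (s : (Fin I → ℕ) × (Fin I → ℕ)) : ℝ :=
  ∑ i, (ell i : ℝ) / mu i * ((s.1 i : ℝ) - (s.2 i : ℝ))

end MultiserverJob

end

/-!
Why the bound holds. For a function `f` of the numbers `x` of jobs, let `gen f (x, z)` be its drift
when `z` jobs are in service. A steady-state distribution `π` satisfies the adjoint relation
`∫ gen f ∂π = 0` for every bounded `f`. This comes from Dynkin's formula (`IsProcess.dynkin`), which
is proved by cutting `[0, T]` into short pieces: on a piece with at most one jump, `f(X)` has an exact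
first-order expansion, whose mean is given by the independence of the Poisson increments and by the
martingale property of the departures; pieces with several jumps disappear in the limit because the
jumps of a counting path are separated. Dividing by `T` gives the adjoint relation for functions
supported in a box, hence, by dominated convergence, for all bounded ones
(`IsSteadyState.isAdjointLaw`). After this point only the discrete law `π` matters.

Let `W = ∑ᵢ (ℓᵢ / μᵢ) xᵢ` be the work and `U` the number of idle servers. Single-type test functions
give `μᵢ E[zᵢ] = λᵢ`, so `E[U] = δ` and the work in service has mean `c = ∑ᵢ (ℓᵢ / μᵢ) ρᵢ`, where
`ρᵢ = λᵢ / μᵢ`. If the mean workload is finite, as may be assumed, the adjoint relation extends by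
truncation to `W²`, whose drift is `2 W (U - δ) + ∑ᵢ (ℓᵢ / μᵢ)² (λᵢ + μᵢ zᵢ)`. Hence
`δ E[W] = σ² + E[W U]` (`IsAdjointLaw.slack_mul_integral_work`), and, centring `W`,
`δ E[workload] = σ² + E[(W - c) U]`. So the policy can beat
`σ² / δ` only by idling while `W` is below `c`. But a type-`i` job leaves at rate at most `μᵢ`,
whatever the policy does, so `xᵢ` is at least as large as in an infinite-server queue, and
`xᵢ < ρᵢ - 2 √ρᵢ log n` has probability at most `(ρᵢ + 1) exp(1 / 2 - log² n)`
(`IsAdjointLaw.measure_lower_tail_le`, from the recursion `λᵢ P(xᵢ = k) ≤ μᵢ (k + 1) P(xᵢ = k + 1)`).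
As `(ℓᵢ / μᵢ) √ρᵢ ≤ σ / √μᵢ` and `E[U] = δ`, the loss is `O(δ σ log n)` plus a term that vanishes, and
`δ log n = o(σ)` makes it `o(σ²)` (`tendsto_relLoss`). The bound on `ℓ_max` only serves to give `δ ≥ 1`
eventually.
-/

namespace MultiserverJob

/-! ### Counting paths and jump expansions -/

/-- On a compact time interval the jumps of a counting path are separated: increments over short
enough intervals are at most one. -/
theorem IsCountingPath.exists_mesh {N : ℝ≥0 → ℕ} (hN : IsCountingPath N) (T : ℝ≥0) :
    ∃ h : ℝ, 0 < h ∧ ∀ s t : ℝ≥0, s ≤ t → t ≤ T → (t : ℝ) - s < h → N t ≤ N s + 1 := by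
  obtain ⟨h, hh, H⟩ := lebesgue_number_lemma_of_metric (s := Set.Icc (0 : ℝ≥0) T)
    (c := fun t : ℝ≥0 => interior {x | N t ≤ N x + 1 ∧ N x ≤ N t}) isCompact_Icc
    (fun _ => isOpen_interior) (by
      intro t _
      refine Set.mem_iUnion.2 ⟨t, mem_interior_iff_mem_nhds.2 ?_⟩
      obtain ⟨u, hu, hNu⟩ := hN.rightCont t
      rcases eq_or_lt_of_le ((zero_le : 0 ≤ t)) with h0 | h0
      · subst h0
        filter_upwards [Iio_mem_nhds hu] with x hx
        rw [← hNu]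
        exact ⟨by rw [hNu, hN.zero]; omega, hN.mono hx.le⟩
      · obtain ⟨v, hv, hNv⟩ := hN.unitJump t h0
        filter_upwards [Ioo_mem_nhds hv hu] with x hx
        exact ⟨hNv.trans (Nat.add_le_add_right (hN.mono hx.1.le) 1), hNu ▸ hN.mono hx.2.le⟩)
  refine ⟨h, hh, fun s t hst htT hlt => ?_⟩
  obtain ⟨c, hc⟩ := H t ⟨zero_le, htT⟩
  have h1 := interior_subset (hc (Metric.mem_ball_self hh))
  have h2 := interior_subset (hc (show s ∈ Metric.ball t h by
    rw [Metric.mem_ball, NNReal.dist_eq, abs_sub_comm, abs_of_nonneg]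
    · exact hlt
    · exact sub_nonneg.2 (by exact_mod_cast hst)))
  exact h1.2.trans h2.1

/-- The increment `k` of a counting path over an interval if it is at least two, and `0`
otherwise. -/
noncomputable def multiJump (k : ℕ) : ℝ := if 2 ≤ k then k else 0

lemma multiJump_nonneg (k : ℕ) : 0 ≤ multiJump k := by
  unfold multiJump; split_ifs <;> positivity

lemma multiJump_le (k : ℕ) : multiJump k ≤ k := by
  unfold multiJump; split_ifs <;> simp

variable {I : ℕ}

/-- First-order expansion of a function of the state over an interval with `α i` arrivals and `β i`
departures of type `i`; it is exact unless several jumps occur. -/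
lemma abs_sub_expansion_le {f : (Fin I → ℕ) → ℝ} {C : ℝ} (hf : ∀ x, |f x| ≤ C)
    (x y α β : Fin I → ℕ) (h : ∀ i, y i + β i = x i + α i) :
    |f y - f x - ∑ i, ((α i : ℝ) * (f (x + Pi.single i 1) - f x)
      + (β i : ℝ) * (f (x - Pi.single i 1) - f x))| ≤
      3 * C * multiJump (∑ i, (α i + β i)) := by
  have hC : 0 ≤ C := (abs_nonneg _).trans (hf x)
  have hd : ∀ y z, |f y - f z| ≤ 2 * C := fun y z => by
    have := abs_sub (f y) (f z); linarith [hf y, hf z]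
  by_cases h2 : 2 ≤ ∑ i, (α i + β i)
  · have hs : |∑ i, ((α i : ℝ) * (f (x + Pi.single i 1) - f x)
      + (β i : ℝ) * (f (x - Pi.single i 1) - f x))| ≤ 2 * C * ((∑ i, (α i + β i) : ℕ) : ℝ) := by
      refine (Finset.abs_sum_le_sum_abs _ _).trans ?_
      push_cast
      rw [Finset.mul_sum]
      refine Finset.sum_le_sum fun i _ => ?_
      refine (abs_add_le _ _).trans ?_
      rw [abs_mul, abs_mul, Nat.abs_cast, Nat.abs_cast, mul_add, mul_comm (2 * C),
        mul_comm (2 * C)]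
      gcongr <;> apply hd
    have h2' : (2 : ℝ) ≤ ((∑ i, (α i + β i) : ℕ) : ℝ) := by exact_mod_cast h2
    rw [multiJump, if_pos h2]
    refine (abs_sub _ _).trans ?_
    have := hd y x
    nlinarith
  · rw [multiJump, if_neg h2]
    have key : f y - f x = ∑ i, ((α i : ℝ) * (f (x + Pi.single i 1) - f x)
      + (β i : ℝ) * (f (x - Pi.single i 1) - f x)) := by
      by_cases h0 : ∑ i, (α i + β i) = 0
      · have h0' : ∀ i, α i + β i = 0 := fun i => by
          simpa using (Finset.sum_eq_zero_iff.1 h0) i (Finset.mem_univ i)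
        have hyx : y = x := by ext i; have := h i; have := h0' i; omega
        rw [Finset.sum_eq_zero]
        · simp [hyx]
        · intro i _
          have := h0' i
          rw [show α i = 0 by omega, show β i = 0 by omega]; simp
      · obtain ⟨i, hi⟩ : ∃ i, α i + β i ≠ 0 := by
          by_contra! hc
          exact h0 (Finset.sum_eq_zero fun i _ => hc i)
        have hsplit := Finset.add_sum_erase Finset.univ (fun i => α i + β i) (Finset.mem_univ i)
        have hrest : ∑ j ∈ Finset.univ.erase i, (α j + β j) = 0 := by omega
        have hj : ∀ j, j ≠ i → α j + β j = 0 := fun j hj => by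
          simpa using (Finset.sum_eq_zero_iff.1 hrest) j (by simp [hj])
        have h1 : α i + β i = 1 := by omega
        rw [Finset.sum_eq_single i]
        · rcases Nat.eq_zero_or_pos (α i) with ha | ha
          · have hb : β i = 1 := by omega
            have : y = x - Pi.single i 1 := by
              ext j
              have := h j
              by_cases hji : j = i
              · subst hji; simp; omega
              · have := hj j hji; simp [hji]; omega
            rw [ha, hb, this]; simp
          · have hb : β i = 0 := by omega
            have : y = x + Pi.single i 1 := by
              ext j
              have := h j
              by_cases hji : j = i
              · subst hji; simp; omega
              · have := hj j hji; simp [hji]; omega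
            rw [hb, show α i = 1 by omega, this]; simp
        · intro j _ hji
          have := hj j hji
          rw [show α j = 0 by omega, show β j = 0 by omega]; simp
        · simp
    rw [key]; simp

/-- Along ever finer equidistant partitions of `[0, T]`, multiple jumps of a counting path
eventually disappear. -/
lemma IsCountingPath.eventually_sum_multiJump {N : ℝ≥0 → ℕ} (hN : IsCountingPath N) (T : ℝ≥0) :
    ∀ᶠ m : ℕ in atTop, ∑ k ∈ Finset.range m,
      multiJump (N (T * (k + 1 : ℕ) / m) - N (T * k / m)) = 0 := by
  obtain ⟨h, hh, H⟩ := hN.exists_mesh T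
  have hlim : Tendsto (fun m : ℕ => (T : ℝ) / m) atTop (𝓝 0) :=
    tendsto_const_div_atTop_nhds_zero_nat _
  filter_upwards [hlim.eventually (gt_mem_nhds hh), eventually_gt_atTop 0] with m hm hm0
  refine Finset.sum_eq_zero fun k hk => ?_
  have hk' : k + 1 ≤ m := Finset.mem_range.1 hk
  have hm0' : (m : ℝ) ≠ 0 := by positivity
  have := H (T * k / m) (T * (k + 1 : ℕ) / m) (by gcongr; exact Nat.le_succ k) (by
    rw [div_le_iff₀ (by positivity)]
    gcongr) (by
    refine lt_of_eq_of_lt ?_ hm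
    push_cast; field_simp; ring)
  rw [multiJump, if_neg (by omega)]

lemma sum_multiJump_le {N : ℝ≥0 → ℕ} (hN : Monotone N) (T : ℝ≥0) {m : ℕ} (hm : 0 < m) :
    ∑ k ∈ Finset.range m, multiJump (N (T * (k + 1 : ℕ) / m) - N (T * k / m)) ≤ N T := by
  have hmono : Monotone fun k : ℕ => N (T * k / m) := fun a b hab => hN (by gcongr)
  calc _ ≤ ∑ k ∈ Finset.range m, ((N (T * (k + 1 : ℕ) / m) - N (T * k / m) : ℕ) : ℝ) :=
        Finset.sum_le_sum fun k _ => multiJump_le _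
    _ ≤ N T := by
        rw [← Nat.cast_sum, Finset.sum_range_tsub hmono]
        rw [mul_div_cancel_right₀ _ (by positivity)]
        exact_mod_cast Nat.sub_le _ _

/-! ### Means and measurability of the driving processes -/

lemma hasSum_mean_poisson (r : ℝ≥0) :
    HasSum (fun k : ℕ => (Real.exp (-r) * (r : ℝ) ^ k / k.factorial) * (k : ℝ)) r := by
  rw [← hasSum_nat_add_iff' 1]
  have := (hasSum_one_poissonMeasure r).mul_left (r : ℝ)
  simp only [Finset.range_one, Finset.sum_singleton, Nat.cast_zero, mul_zero, sub_zero]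
  rw [mul_one] at this
  have e : (fun k : ℕ => (Real.exp (-r) * (r : ℝ) ^ (k + 1) / (k + 1).factorial) *
      ((k + 1 : ℕ) : ℝ)) = fun k : ℕ => (r : ℝ) * (Real.exp (-r) * (r : ℝ) ^ k / k.factorial) := by
    funext k
    rw [Nat.factorial_succ]
    push_cast
    field_simp
    rw [pow_succ']
  rw [e]
  exact this

lemma integrable_natCast_poissonMeasure (r : ℝ≥0) :
    Integrable (fun k : ℕ => (k : ℝ)) (poissonMeasure r) := by
  rw [integrable_poissonMeasure_iff]
  simpa using (hasSum_mean_poisson r).summable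

lemma integral_natCast_poissonMeasure (r : ℝ≥0) :
    ∫ k : ℕ, (k : ℝ) ∂(poissonMeasure r) = r := by
  refine (hasSum_integral_poissonMeasure (integrable_natCast_poissonMeasure r)).unique ?_
  simpa using hasSum_mean_poisson r

variable {n : ℕ} {lam : Fin I → ℝ≥0} {ell : Fin I → ℕ} {mu : Fin I → ℝ}
  {Ω : Type*} {mΩ : MeasurableSpace Ω} {P : Measure Ω} {ℱ : Filtration ℝ≥0 mΩ}
  {X Z A D : ℝ≥0 → Ω → Fin I → ℕ}

namespace IsProcess

lemma counts_zero (h : IsProcess n lam ell mu P ℱ X Z A D) :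
    ∀ᵐ ω ∂P, ∀ i, A 0 ω i = 0 ∧ D 0 ω i = 0 := by
  filter_upwards [h.simple] with ω hω i
  have := hω.zero
  simp only [Finset.sum_eq_zero_iff, Finset.mem_univ, true_imp_iff] at this
  have := this i
  omega

lemma service_le_servers (h : IsProcess n lam ell mu P ℱ X Z A D) (hell : ∀ i, 0 < ell i) :
    ∀ᵐ ω ∂P, ∀ t i, Z t ω i ≤ n := by
  filter_upwards [h.capacity] with ω hω t i
  refine le_trans ?_ (hω t)
  exact (Nat.le_mul_of_pos_left _ (hell i)).trans
    (Finset.single_le_sum (f := fun i => ell i * Z t ω i) (fun _ _ => Nat.zero_le _)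
      (Finset.mem_univ i))

lemma measurable_X (h : IsProcess n lam ell mu P ℱ X Z A D) (t : ℝ≥0) : Measurable (X t) :=
  (h.adapted_X t).mono (ℱ.le t) le_rfl

lemma measurable_A (h : IsProcess n lam ell mu P ℱ X Z A D) (t : ℝ≥0) : Measurable (A t) :=
  (h.adapted_A t).mono (ℱ.le t) le_rfl

lemma measurable_D (h : IsProcess n lam ell mu P ℱ X Z A D) (t : ℝ≥0) : Measurable (D t) :=
  (h.adapted_D t).mono (ℱ.le t) le_rfl

lemma measurable_Z_min (h : IsProcess n lam ell mu P ℱ X Z A D) (T : ℝ≥0) :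
    Measurable fun p : ℝ × Ω => Z (min p.1.toNNReal T) p.2 := by
  have hm : Measurable (fun p : Set.Iic T × Ω => Z p.1 p.2) :=
    ((h.progressive_Z T).mono (sup_le_sup_left
      (MeasurableSpace.comap_mono (ℱ.le T)) _)).measurable
  have hg : Measurable fun p : ℝ × Ω =>
      ((⟨min p.1.toNNReal T, Set.mem_Iic.2 (min_le_right _ _)⟩ : Set.Iic T), p.2) := by
    refine Measurable.prodMk (Measurable.subtype_mk ?_) measurable_snd
    exact (measurable_real_toNNReal.comp measurable_fst).min measurable_const
  exact hm.comp hg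

lemma aemeasurable_Z (h : IsProcess n lam ell mu P ℱ X Z A D) [SFinite P] (s t : ℝ≥0) :
    AEMeasurable (fun p : ℝ × Ω => Z p.1.toNNReal p.2)
      ((volume.restrict (Set.Ioc (s : ℝ) t)).prod P) := by
  refine ⟨_, h.measurable_Z_min t, ?_⟩
  have : ∀ᵐ u : ℝ ∂(volume.restrict (Set.Ioc (s : ℝ) t)), u.toNNReal ≤ t := by
    filter_upwards [ae_restrict_mem measurableSet_Ioc] with u hu
    exact Real.toNNReal_le_iff_le_coe.2 hu.2
  filter_upwards [Measure.quasiMeasurePreserving_fst.ae this] with p hp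
  rw [min_eq_left hp]

lemma balance_diff (h : IsProcess n lam ell mu P ℱ X Z A D) : ∀ᵐ ω ∂P, ∀ s t, s ≤ t → ∀ i,
    X t ω i + (D t ω i - D s ω i) = X s ω i + (A t ω i - A s ω i) := by
  filter_upwards [h.balance, h.mono_A, h.mono_D] with ω hb hA hD s t hst i
  have h1 := hb t i
  have h2 := hb s i
  have h3 := hA i hst
  have h4 := hD i hst
  simp only at h3 h4
  omega

lemma total_diff (h : IsProcess n lam ell mu P ℱ X Z A D) : ∀ᵐ ω ∂P, ∀ s t, s ≤ t →
    ∑ i, ((A t ω i - A s ω i) + (D t ω i - D s ω i)) =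
      ∑ i, (A t ω i + D t ω i) - ∑ i, (A s ω i + D s ω i) := by
  filter_upwards [h.mono_A, h.mono_D] with ω hA hD s t hst
  have : ∑ i, (A t ω i + D t ω i) = ∑ i, (A s ω i + D s ω i) +
      ∑ i, ((A t ω i - A s ω i) + (D t ω i - D s ω i)) := by
    rw [← Finset.sum_add_distrib]
    refine Finset.sum_congr rfl fun i _ => ?_
    have h3 := hA i hst
    have h4 := hD i hst
    simp only at h3 h4
    omega
  omega

/-- The state can only change if some arrival or departure happens. -/
lemma eq_of_total_eq (h : IsProcess n lam ell mu P ℱ X Z A D) : ∀ᵐ ω ∂P, ∀ s t, s ≤ t →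
    ∑ i, (A t ω i + D t ω i) = ∑ i, (A s ω i + D s ω i) → X t ω = X s ω := by
  filter_upwards [h.balance_diff, h.total_diff] with ω hb ht s t hst heq
  have h1 := ht s t hst
  rw [heq, Nat.sub_self, Finset.sum_eq_zero_iff] at h1
  ext i
  have h2 := h1 i (Finset.mem_univ i)
  have h3 := hb s t hst i
  omega

/-- Right-continuity makes `X` jointly measurable: it is the limit of its values at the next
point of a fine grid. -/
lemma aemeasurable_X (h : IsProcess n lam ell mu P ℱ X Z A D) [SFinite P] (ν : Measure ℝ)
    [SFinite ν] : AEMeasurable (fun p : ℝ × Ω => X p.1.toNNReal p.2) (ν.prod P) := by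
  refine aemeasurable_of_tendsto_metrizable_ae atTop
    (f := fun (m : ℕ) (p : ℝ × Ω) => X ((⌈p.1.toNNReal * (m + 1)⌉₊ : ℝ≥0) / (m + 1)) p.2)
    (fun m => Measurable.aemeasurable ?_) ?_
  · have h1 : Measurable fun p : ℕ × Ω => X ((p.1 : ℝ≥0) / (m + 1)) p.2 :=
      measurable_from_prod_countable_right fun k => h.measurable_X ((k : ℝ≥0) / (m + 1))
    have h2 : Measurable fun p : ℝ × Ω => (⌈p.1.toNNReal * ((m : ℝ≥0) + 1)⌉₊, p.2) := by
      refine Measurable.prodMk ?_ measurable_snd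
      exact Nat.measurable_ceil.comp
        ((measurable_real_toNNReal.comp measurable_fst).mul_const _)
    exact h1.comp h2
  · have key : ∀ᵐ ω ∂P, ∀ t : ℝ≥0,
        ∀ᶠ m : ℕ in atTop, X ((⌈t * ((m : ℝ≥0) + 1)⌉₊ : ℝ≥0) / (m + 1)) ω = X t ω := by
      filter_upwards [h.simple, h.eq_of_total_eq] with ω hN hX t
      obtain ⟨u, htu, hu⟩ := hN.rightCont t
      have hpos : (0 : ℝ) < u - t := sub_pos.2 (by exact_mod_cast htu)
      have hlim := tendsto_one_div_add_atTop_nhds_zero_nat (𝕜 := ℝ)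
      filter_upwards [hlim.eventually (gt_mem_nhds hpos)] with m hm
      have hm1 : (0 : ℝ≥0) < (m : ℝ≥0) + 1 := by positivity
      have hle : t ≤ (⌈t * ((m : ℝ≥0) + 1)⌉₊ : ℝ≥0) / (m + 1) := by
        rw [le_div_iff₀ hm1]; exact Nat.le_ceil _
      have hlt : (⌈t * ((m : ℝ≥0) + 1)⌉₊ : ℝ≥0) / (m + 1) ≤ u := by
        rw [div_le_iff₀ hm1]
        have h1 : (⌈t * ((m : ℝ≥0) + 1)⌉₊ : ℝ≥0) < t * ((m : ℝ≥0) + 1) + 1 :=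
          Nat.ceil_lt_add_one zero_le
        have h2 : (t : ℝ) * (m + 1) + 1 ≤ u * (m + 1) := by
          have hm1' : (0 : ℝ) < (m : ℝ) + 1 := by positivity
          rw [div_lt_iff₀ hm1'] at hm
          linear_combination hm.le
        exact h1.le.trans (by exact_mod_cast h2)
      refine hX t _ hle (le_antisymm ?_ (hN.mono hle))
      rw [← hu]; exact hN.mono hlt
    filter_upwards [Measure.quasiMeasurePreserving_snd.ae key] with p hp
    exact tendsto_const_nhds.congr' ((hp p.1.toNNReal).mono fun m hm => hm.symm)

lemma integrable_arrivals (h : IsProcess n lam ell mu P ℱ X Z A D) (i : Fin I) {s t : ℝ≥0}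
    (hst : s ≤ t) : Integrable (fun ω => ((A t ω i - A s ω i : ℕ) : ℝ)) P := by
  have hl := h.poisson i s t hst
  have := integrable_natCast_poissonMeasure (lam i * (t - s))
  rw [← hl.map_eq] at this
  exact this.comp_aemeasurable hl.aemeasurable

lemma integral_arrivals (h : IsProcess n lam ell mu P ℱ X Z A D) (i : Fin I) {s t : ℝ≥0}
    (hst : s ≤ t) : ∫ ω, ((A t ω i - A s ω i : ℕ) : ℝ) ∂P = lam i * (t - s) := by
  have hl := h.poisson i s t hst
  have := integral_natCast_poissonMeasure (lam i * (t - s))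
  rw [← hl.map_eq, integral_map hl.aemeasurable Measurable.of_discrete.aestronglyMeasurable] at this
  rw [this, NNReal.coe_mul, NNReal.coe_sub hst]

lemma integral_arrivals_mul (h : IsProcess n lam ell mu P ℱ X Z A D) (i : Fin I) {s t : ℝ≥0}
    (hst : s ≤ t) (g : (Fin I → ℕ) → ℝ) :
    ∫ ω, ((A t ω i - A s ω i : ℕ) : ℝ) * g (X s ω) ∂P = lam i * (t - s) * ∫ ω, g (X s ω) ∂P := by
  have hind : IndepFun (fun ω => ((A t ω i - A s ω i : ℕ) : ℝ)) (fun ω => g (X s ω)) P := by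
    have h1 : IndepFun (fun ω i => A t ω i - A s ω i) (X s) P :=
      indep_of_indep_of_le_right (h.indep_past s t hst) (h.adapted_X s).comap_le
    exact h1.comp (φ := fun a => (a i : ℝ)) (ψ := g) Measurable.of_discrete Measurable.of_discrete
  rw [hind.integral_fun_mul_eq_mul_integral (h.integrable_arrivals i hst).aestronglyMeasurable
    ((Measurable.of_discrete (f := g)).comp (h.measurable_X s)).aestronglyMeasurable,
    h.integral_arrivals i hst]

end IsProcess

/-! ### The generator and expected increments -/

/-- The generator of the system: `gen lam mu f (x, z)` is the infinitesimal drift of `f(X)` when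
the state is `x` and `z i` jobs of type `i` are in service. -/
noncomputable def gen (lam : Fin I → ℝ≥0) (mu : Fin I → ℝ) (f : (Fin I → ℕ) → ℝ)
    (s : (Fin I → ℕ) × (Fin I → ℕ)) : ℝ :=
  ∑ i, ((lam i : ℝ) * (f (s.1 + Pi.single i 1) - f s.1)
    + mu i * s.2 i * (f (s.1 - Pi.single i 1) - f s.1))

/-- An upper bound on the total rate of arrivals and departures with `n` servers. -/
noncomputable def maxRate (n : ℕ) (lam : Fin I → ℝ≥0) (mu : Fin I → ℝ) : ℝ := ∑ i, ((lam i : ℝ) + mu i * n)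

lemma maxRate_nonneg (hmu : ∀ i, 0 < mu i) : 0 ≤ maxRate n lam mu :=
  Finset.sum_nonneg fun i _ => by have := hmu i; positivity

lemma abs_gen_le (hmu : ∀ i, 0 < mu i) {f : (Fin I → ℕ) → ℝ} {C : ℝ} (hf : ∀ x, |f x| ≤ C)
    {s : (Fin I → ℕ) × (Fin I → ℕ)} (hs : ∀ i, s.2 i ≤ n) :
    |gen lam mu f s| ≤ 2 * C * maxRate n lam mu := by
  have hC : 0 ≤ C := (abs_nonneg _).trans (hf 0)
  have hd : ∀ y z, |f y - f z| ≤ 2 * C := fun y z => by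
    have := abs_sub (f y) (f z); linarith [hf y, hf z]
  refine (Finset.abs_sum_le_sum_abs _ _).trans ?_
  rw [maxRate, Finset.mul_sum]
  refine Finset.sum_le_sum fun i _ => ?_
  have h1 : (s.2 i : ℝ) ≤ n := by exact_mod_cast hs i
  have h2 := hmu i
  refine (abs_add_le _ _).trans ?_
  rw [abs_mul, abs_mul, abs_of_nonneg (lam i).coe_nonneg,
    abs_of_nonneg (show 0 ≤ mu i * (s.2 i : ℝ) by positivity), mul_add, mul_comm (2 * C),
    mul_comm (2 * C)]
  gcongr <;> apply hd

namespace IsProcess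

lemma integrable_service (h : IsProcess n lam ell mu P ℱ X Z A D) [IsProbabilityMeasure P]
    (hell : ∀ i, 0 < ell i) (s t : ℝ≥0) (i : Fin I) :
    Integrable (fun p : ℝ × Ω => (Z p.1.toNNReal p.2 i : ℝ))
      ((volume.restrict (Set.Ioc (s : ℝ) t)).prod P) := by
  refine Integrable.of_bound (C := n) ?_ ?_
  · exact ((Measurable.of_discrete (f := fun z : Fin I → ℕ => (z i : ℝ))).comp_aemeasurable
      (h.aemeasurable_Z s t)).aestronglyMeasurable
  · filter_upwards [Measure.quasiMeasurePreserving_snd.ae (h.service_le_servers hell)] with p hp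
    rw [Real.norm_natCast]
    exact_mod_cast hp _ _

lemma ae_intervalIntegrable_service (h : IsProcess n lam ell mu P ℱ X Z A D)
    [IsProbabilityMeasure P] (hell : ∀ i, 0 < ell i) (s t : ℝ≥0) (hst : s ≤ t) (i : Fin I) :
    ∀ᵐ ω ∂P, IntervalIntegrable (fun u : ℝ => (Z u.toNNReal ω i : ℝ)) volume s t := by
  filter_upwards [(h.integrable_service hell s t i).prod_left_ae] with ω hω
  rw [intervalIntegrable_iff_integrableOn_Ioc_of_le (by exact_mod_cast hst)]
  exact hω

lemma integrable_departures (h : IsProcess n lam ell mu P ℱ X Z A D) [IsProbabilityMeasure P]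
    (hell : ∀ i, 0 < ell i) (i : Fin I) (t : ℝ≥0) : Integrable (fun ω => (D t ω i : ℝ)) P := by
  have h1 := (h.departure_intensity i).integrable t
  have h2 : Integrable (fun ω => ∫ u in (0 : ℝ)..t, (Z u.toNNReal ω i : ℝ)) P := by
    have := (h.integrable_service hell 0 t i).integral_prod_right
    refine this.congr (ae_of_all _ fun ω => ?_)
    simp only
    rw [intervalIntegral.integral_of_le t.coe_nonneg, NNReal.coe_zero]
  refine (h1.add (h2.const_mul (mu i))).congr (ae_of_all _ fun ω => ?_)
  simp

lemma integrable_departures_sub (h : IsProcess n lam ell mu P ℱ X Z A D)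
    [IsProbabilityMeasure P] (hell : ∀ i, 0 < ell i) (i : Fin I) {s t : ℝ≥0} (hst : s ≤ t) :
    Integrable (fun ω => ((D t ω i - D s ω i : ℕ) : ℝ)) P := by
  refine ((h.integrable_departures hell i t).sub (h.integrable_departures hell i s)).congr ?_
  filter_upwards [h.mono_D] with ω hω
  simp only [Pi.sub_apply]
  rw [Nat.cast_sub (hω i hst)]

/-- Given the past, departures of type `i` have mean `μᵢ ∫ Zᵢ`: the martingale property tested
against a bounded function of the present state. -/
lemma integral_departures_mul (h : IsProcess n lam ell mu P ℱ X Z A D) [IsProbabilityMeasure P]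
    (hell : ∀ i, 0 < ell i) (i : Fin I) {s t : ℝ≥0} (hst : s ≤ t) {g : (Fin I → ℕ) → ℝ} {C : ℝ}
    (hg : ∀ x, |g x| ≤ C) :
    ∫ ω, ((D t ω i - D s ω i : ℕ) : ℝ) * g (X s ω) ∂P =
      ∫ u in (s : ℝ)..t, ∫ ω, mu i * Z u.toNNReal ω i * g (X s ω) ∂P := by
  have hM := h.departure_intensity i
  set M := fun (t : ℝ≥0) ω => (D t ω i : ℝ) - mu i * ∫ s in (0 : ℝ)..t, (Z s.toNNReal ω i : ℝ)
    with hMdef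
  have hgm : StronglyMeasurable[ℱ s] fun ω => g (X s ω) :=
    ((Measurable.of_discrete (f := g)).comp (h.adapted_X s)).stronglyMeasurable
  have hMi : Integrable (fun ω => M t ω - M s ω) P := (hM.integrable t).sub (hM.integrable s)
  have hgb : ∀ᵐ ω ∂P, ‖g (X s ω)‖ ≤ C := ae_of_all _ fun ω => hg _
  have hgM : Integrable (fun ω => g (X s ω) * (M t ω - M s ω)) P :=
    hMi.bdd_mul (hgm.mono (ℱ.le s)).aestronglyMeasurable hgb
  have hzero : ∫ ω, g (X s ω) * (M t ω - M s ω) ∂P = 0 := by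
    rw [← integral_condExp (ℱ.le s)]
    have h1 := condExp_stronglyMeasurable_mul_of_bound (ℱ.le s) hgm hMi C hgb
    have h2 : P[fun ω => M t ω - M s ω | ℱ s] =ᵐ[P] 0 := by
      have h3 := condExp_sub (hM.integrable t) (hM.integrable s) (ℱ s)
      filter_upwards [h3, hM.condExp_ae_eq hst, hM.condExp_ae_eq (le_refl s)] with ω e1 e2 e3
      rw [show (fun ω => M t ω - M s ω) = M t - M s from rfl, e1, Pi.sub_apply, e2, e3]
      simp
    rw [integral_congr_ae (g := fun _ => (0 : ℝ)), integral_zero]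
    filter_upwards [h1, h2] with ω e1 e2
    rw [show (fun ω => g (X s ω) * (M t ω - M s ω)) =
      (fun ω => g (X s ω)) * (fun ω => M t ω - M s ω) from rfl, e1, Pi.mul_apply, e2]
    simp
  have hDi := h.integrable_departures_sub hell i hst
  have hgD : Integrable (fun ω => g (X s ω) * ((D t ω i - D s ω i : ℕ) : ℝ)) P :=
    hDi.bdd_mul (hgm.mono (ℱ.le s)).aestronglyMeasurable hgb
  have hprod : Integrable (fun p : ℝ × Ω => mu i * Z p.1.toNNReal p.2 i * g (X s p.2))
      ((volume.restrict (Set.Ioc (s : ℝ) t)).prod P) := by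
    refine ((h.integrable_service hell s t i).const_mul (mu i)).mul_bdd (c := C) ?_ ?_
    · exact ((hgm.mono (ℱ.le s)).comp_measurable measurable_snd).aestronglyMeasurable
    · exact ae_of_all _ fun p => hg _
  have hpath : ∀ᵐ ω ∂P, g (X s ω) * (M t ω - M s ω) =
      ((D t ω i - D s ω i : ℕ) : ℝ) * g (X s ω) -
        ∫ u in (s : ℝ)..t, mu i * Z u.toNNReal ω i * g (X s ω) := by
    filter_upwards [h.mono_D, h.ae_intervalIntegrable_service hell 0 s zero_le i,
      h.ae_intervalIntegrable_service hell s t hst i] with ω hD hi1 hi2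
    rw [Nat.cast_sub (hD i hst), intervalIntegral.integral_mul_const,
      intervalIntegral.integral_const_mul, hMdef]
    have := intervalIntegral.integral_add_adjacent_intervals hi1 hi2
    rw [NNReal.coe_zero] at this
    simp only [← this]
    ring
  have hst' : (s : ℝ) ≤ t := by exact_mod_cast hst
  have hsw : ∫ u in (s : ℝ)..t, ∫ ω, mu i * Z u.toNNReal ω i * g (X s ω) ∂P =
      ∫ ω, (∫ u in (s : ℝ)..t, mu i * Z u.toNNReal ω i * g (X s ω)) ∂P := by
    simp only [intervalIntegral.integral_of_le hst']
    exact integral_integral_swap hprod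
  have hIi : Integrable (fun ω => ∫ u in (s : ℝ)..t, mu i * Z u.toNNReal ω i * g (X s ω)) P := by
    simp only [intervalIntegral.integral_of_le hst']
    exact hprod.integral_prod_right
  rw [integral_congr_ae hpath, integral_sub (by simpa only [mul_comm] using hgD) hIi] at hzero
  rw [hsw]
  linarith

lemma integral_departures_le (h : IsProcess n lam ell mu P ℱ X Z A D) [IsProbabilityMeasure P]
    (hmu : ∀ i, 0 < mu i) (hell : ∀ i, 0 < ell i) (i : Fin I) {s t : ℝ≥0} (hst : s ≤ t) :
    ∫ ω, ((D t ω i - D s ω i : ℕ) : ℝ) ∂P ≤ mu i * n * (t - s) := by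
  have h1 := h.integral_departures_mul hell i hst (g := fun _ => 1) (C := 1) (by simp)
  simp only [mul_one] at h1
  have hst' : (s : ℝ) ≤ t := by exact_mod_cast hst
  rw [h1]
  have := intervalIntegral.norm_integral_le_of_norm_le_const (a := (s : ℝ)) (b := t)
    (C := mu i * n) (f := fun u : ℝ => ∫ ω, mu i * (Z u.toNNReal ω i : ℝ) ∂P) (fun u _ => by
      have := norm_integral_le_of_norm_le_const (μ := P) (C := mu i * n)
        (f := fun ω => mu i * (Z u.toNNReal ω i : ℝ)) (by
          filter_upwards [h.service_le_servers hell] with ω hω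
          have h2 := hmu i
          have h3 : (Z u.toNNReal ω i : ℝ) ≤ n := by exact_mod_cast hω _ _
          rw [Real.norm_of_nonneg (by positivity)]
          gcongr)
      simpa using this)
  rw [abs_of_nonneg (sub_nonneg.2 hst')] at this
  exact (le_abs_self _).trans this

lemma integrable_total_sub (h : IsProcess n lam ell mu P ℱ X Z A D) [IsProbabilityMeasure P]
    (hell : ∀ i, 0 < ell i) {s t : ℝ≥0} (hst : s ≤ t) :
    Integrable (fun ω => ((∑ i, ((A t ω i - A s ω i) + (D t ω i - D s ω i)) : ℕ) : ℝ)) P := by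
  push_cast
  exact integrable_finsetSum _ fun i _ =>
    (h.integrable_arrivals i hst).add (h.integrable_departures_sub hell i hst)

lemma integral_total_sub_le (h : IsProcess n lam ell mu P ℱ X Z A D) [IsProbabilityMeasure P]
    (hmu : ∀ i, 0 < mu i) (hell : ∀ i, 0 < ell i) {s t : ℝ≥0} (hst : s ≤ t) :
    ∫ ω, ((∑ i, ((A t ω i - A s ω i) + (D t ω i - D s ω i)) : ℕ) : ℝ) ∂P ≤
      maxRate n lam mu * (t - s) := by
  push_cast
  rw [integral_finsetSum (f := fun i ω => ((A t ω i - A s ω i : ℕ) : ℝ) +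
    ((D t ω i - D s ω i : ℕ) : ℝ)) _ fun i _ =>
      (h.integrable_arrivals i hst).add (h.integrable_departures_sub hell i hst), maxRate,
    Finset.sum_mul]
  refine Finset.sum_le_sum fun i _ => ?_
  have e := integral_add (h.integrable_arrivals i hst) (h.integrable_departures_sub hell i hst)
  rw [e, h.integral_arrivals i hst, add_mul]
  gcongr
  exact h.integral_departures_le hmu hell i hst

end IsProcess

/-! ### Dynkin's formula -/

lemma integral_integral_finsetSum {ι : Type*} (S : Finset ι) {ν : Measure ℝ} [SFinite ν]
    [SFinite P] {p : ι → ℝ × Ω → ℝ} (hp : ∀ i ∈ S, Integrable (p i) (ν.prod P)) :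
    ∫ u, ∫ ω, ∑ i ∈ S, p i (u, ω) ∂P ∂ν = ∑ i ∈ S, ∫ u, ∫ ω, p i (u, ω) ∂P ∂ν := by
  rw [← integral_prod (fun z => ∑ i ∈ S, p i z) (integrable_finsetSum S hp),
    integral_finsetSum S hp]
  exact Finset.sum_congr rfl fun i hi => integral_prod _ (hp i hi)

/-- The number of arrivals and departures of all types during `(0, t]`. -/
def jumps (A D : ℝ≥0 → Ω → Fin I → ℕ) (t : ℝ≥0) (ω : Ω) : ℕ := ∑ i, (A t ω i + D t ω i)

namespace IsProcess

/-- The drift of `f(X)` evaluated with the state frozen at time `s` but the current service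
decision is jointly integrable. -/
lemma integrable_gen_frozen (h : IsProcess n lam ell mu P ℱ X Z A D) [IsProbabilityMeasure P]
    (hmu : ∀ i, 0 < mu i) (hell : ∀ i, 0 < ell i) {f : (Fin I → ℕ) → ℝ} {C : ℝ}
    (hf : ∀ x, |f x| ≤ C) (s t : ℝ≥0) :
    Integrable (fun p : ℝ × Ω => gen lam mu f (X s p.2, Z p.1.toNNReal p.2))
      ((volume.restrict (Set.Ioc (s : ℝ) t)).prod P) := by
  refine Integrable.of_bound (C := 2 * C * maxRate n lam mu) ?_ ?_
  · exact ((Measurable.of_discrete (f := gen lam mu f)).comp_aemeasurable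
      (((h.measurable_X s).comp measurable_snd).aemeasurable.prodMk
        (h.aemeasurable_Z s t))).aestronglyMeasurable
  · filter_upwards [Measure.quasiMeasurePreserving_snd.ae (h.service_le_servers hell)] with p hp
    exact abs_gen_le hmu hf fun i => hp _ _

lemma integrable_gen (h : IsProcess n lam ell mu P ℱ X Z A D) [IsProbabilityMeasure P]
    (hmu : ∀ i, 0 < mu i) (hell : ∀ i, 0 < ell i) {f : (Fin I → ℕ) → ℝ} {C : ℝ}
    (hf : ∀ x, |f x| ≤ C) (s t : ℝ≥0) :
    Integrable (fun p : ℝ × Ω => gen lam mu f (X p.1.toNNReal p.2, Z p.1.toNNReal p.2))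
      ((volume.restrict (Set.Ioc (s : ℝ) t)).prod P) := by
  refine Integrable.of_bound (C := 2 * C * maxRate n lam mu) ?_ ?_
  · exact ((Measurable.of_discrete (f := gen lam mu f)).comp_aemeasurable
      ((h.aemeasurable_X _).prodMk (h.aemeasurable_Z s t))).aestronglyMeasurable
  · filter_upwards [Measure.quasiMeasurePreserving_snd.ae (h.service_le_servers hell)] with p hp
    exact abs_gen_le hmu hf fun i => hp _ _

lemma intervalIntegrable_gen (h : IsProcess n lam ell mu P ℱ X Z A D) [IsProbabilityMeasure P]
    (hmu : ∀ i, 0 < mu i) (hell : ∀ i, 0 < ell i) {f : (Fin I → ℕ) → ℝ} {C : ℝ}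
    (hf : ∀ x, |f x| ≤ C) {s t : ℝ≥0} (hst : s ≤ t) :
    IntervalIntegrable (fun u : ℝ => ∫ ω, gen lam mu f (X u.toNNReal ω, Z u.toNNReal ω) ∂P)
      volume s t := by
  rw [intervalIntegrable_iff_integrableOn_Ioc_of_le (by exact_mod_cast hst)]
  exact (h.integrable_gen hmu hell hf s t).integral_prod_left

lemma integral_arrivals_mul_eq (h : IsProcess n lam ell mu P ℱ X Z A D)
    (i : Fin I) {s t : ℝ≥0} (hst : s ≤ t) (g : (Fin I → ℕ) → ℝ) :
    ∫ ω, ((A t ω i - A s ω i : ℕ) : ℝ) * g (X s ω) ∂P =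
      ∫ _ in (s : ℝ)..t, ∫ ω, lam i * g (X s ω) ∂P := by
  rw [h.integral_arrivals_mul i hst, intervalIntegral.integral_const, integral_const_mul,
    smul_eq_mul]
  ring

/-- The expected first-order expansion of `f(X)` over `(s, t]`. -/
lemma integral_expansion (h : IsProcess n lam ell mu P ℱ X Z A D) [IsProbabilityMeasure P]
    (hell : ∀ i, 0 < ell i) {f : (Fin I → ℕ) → ℝ} {C : ℝ}
    (hf : ∀ x, |f x| ≤ C) {s t : ℝ≥0} (hst : s ≤ t) :
    Integrable (fun ω => ∑ i, (((A t ω i - A s ω i : ℕ) : ℝ) *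
        (f (X s ω + Pi.single i 1) - f (X s ω)) + ((D t ω i - D s ω i : ℕ) : ℝ) *
        (f (X s ω - Pi.single i 1) - f (X s ω)))) P ∧
    ∫ ω, ∑ i, (((A t ω i - A s ω i : ℕ) : ℝ) *
        (f (X s ω + Pi.single i 1) - f (X s ω)) + ((D t ω i - D s ω i : ℕ) : ℝ) *
        (f (X s ω - Pi.single i 1) - f (X s ω))) ∂P =
      ∫ u in (s : ℝ)..t, ∫ ω, gen lam mu f (X s ω, Z u.toNNReal ω) ∂P := by
  have hst' : (s : ℝ) ≤ t := by exact_mod_cast hst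
  have hd : ∀ y z, |f y - f z| ≤ 2 * C := fun y z => by
    have := abs_sub (f y) (f z); linarith [hf y, hf z]
  have hp : ∀ i x, |f (x + Pi.single i 1) - f x| ≤ 2 * C := fun i x => hd _ _
  have hm : ∀ i x, |f (x - Pi.single i 1) - f x| ≤ 2 * C := fun i x => hd _ _
  have hgen : ∀ s : (Fin I → ℕ) × (Fin I → ℕ), gen lam mu f s = ∑ i, ((lam i : ℝ) *
    (f (s.1 + Pi.single i 1) - f s.1) + mu i * s.2 i * (f (s.1 - Pi.single i 1) - f s.1)) :=
    fun s => rfl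
  simp only [hgen]
  -- only the bounds on the two increments of `f` matter from here on
  generalize hgp : (fun (i : Fin I) (x : Fin I → ℕ) => f (x + Pi.single i 1) - f x) = gp at *
  generalize hgm : (fun (i : Fin I) (x : Fin I → ℕ) => f (x - Pi.single i 1) - f x) = gm at *
  have hgp' : ∀ i x, f (x + Pi.single i 1) - f x = gp i x := fun i x => by rw [← hgp]
  have hgm' : ∀ i x, f (x - Pi.single i 1) - f x = gm i x := fun i x => by rw [← hgm]
  simp only [hgp', hgm'] at *
  clear hgp hgm hgp' hgm' hgen hd
  have hXm : ∀ g : (Fin I → ℕ) → ℝ, AEStronglyMeasurable (fun ω => g (X s ω)) P := fun g =>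
    ((Measurable.of_discrete (f := g)).comp (h.measurable_X s)).aestronglyMeasurable
  have hA : ∀ i, Integrable (fun ω => ((A t ω i - A s ω i : ℕ) : ℝ) * gp i (X s ω)) P := fun i =>
    (h.integrable_arrivals i hst).mul_bdd (c := 2 * C) (hXm (gp i)) (ae_of_all _ fun ω => hp _ _)
  have hD : ∀ i, Integrable (fun ω => ((D t ω i - D s ω i : ℕ) : ℝ) * gm i (X s ω)) P := fun i =>
    (h.integrable_departures_sub hell i hst).mul_bdd (c := 2 * C) (hXm (gm i))
      (ae_of_all _ fun ω => hm _ _)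
  have hAD : ∀ i, Integrable (fun ω => ((A t ω i - A s ω i : ℕ) : ℝ) * gp i (X s ω) +
      ((D t ω i - D s ω i : ℕ) : ℝ) * gm i (X s ω)) P := fun i => (hA i).add (hD i)
  refine ⟨integrable_finsetSum _ fun i _ => hAD i, ?_⟩
  have hpA : ∀ i, Integrable (fun p : ℝ × Ω => (lam i : ℝ) * gp i (X s p.2))
      ((volume.restrict (Set.Ioc (s : ℝ) t)).prod P) := fun i =>
    (Integrable.of_bound (C := 2 * C) (f := fun p : ℝ × Ω => gp i (X s p.2))
      (hXm (gp i)).comp_snd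
      (ae_of_all _ fun p => hp _ _)).const_mul _
  have hpD : ∀ i, Integrable (fun p : ℝ × Ω => mu i * (Z p.1.toNNReal p.2 i : ℝ) *
      gm i (X s p.2)) ((volume.restrict (Set.Ioc (s : ℝ) t)).prod P) := fun i =>
    ((h.integrable_service hell s t i).const_mul (mu i)).mul_bdd (c := 2 * C)
      ((hXm (gm i)).comp_snd (μ := volume.restrict (Set.Ioc (s : ℝ) t)))
      (ae_of_all _ fun p => hm _ _)
  have hpAD : ∀ i, Integrable (fun p : ℝ × Ω => (lam i : ℝ) * gp i (X s p.2) +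
      mu i * (Z p.1.toNNReal p.2 i : ℝ) * gm i (X s p.2))
      ((volume.restrict (Set.Ioc (s : ℝ) t)).prod P) := fun i => (hpA i).add (hpD i)
  rw [integral_finsetSum _ fun i _ => hAD i, intervalIntegral.integral_of_le hst',
    integral_integral_finsetSum Finset.univ (p := fun i (p : ℝ × Ω) =>
      (lam i : ℝ) * gp i (X s p.2) + mu i * (Z p.1.toNNReal p.2 i : ℝ) * gm i (X s p.2))
      fun i _ => hpAD i]
  refine Finset.sum_congr rfl fun i _ => ?_
  rw [integral_add (hA i) (hD i), h.integral_arrivals_mul_eq i hst,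
    h.integral_departures_mul hell i hst (hm i), intervalIntegral.integral_of_le hst',
    intervalIntegral.integral_of_le hst']
  exact (integral_integral_add (hpA i) (hpD i)).symm

/-- Freezing the state over a short interval changes the expected drift only by the probability of
a jump. -/
lemma abs_integral_gen_sub_le (h : IsProcess n lam ell mu P ℱ X Z A D) [IsProbabilityMeasure P]
    (hmu : ∀ i, 0 < mu i) (hell : ∀ i, 0 < ell i) {f : (Fin I → ℕ) → ℝ} {C : ℝ}
    (hf : ∀ x, |f x| ≤ C) {s t : ℝ≥0} (hst : s ≤ t) :
    |(∫ u in (s : ℝ)..t, ∫ ω, gen lam mu f (X s ω, Z u.toNNReal ω) ∂P) -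
      ∫ u in (s : ℝ)..t, ∫ ω, gen lam mu f (X u.toNNReal ω, Z u.toNNReal ω) ∂P| ≤
      4 * C * maxRate n lam mu ^ 2 * ((t : ℝ) - s) ^ 2 := by
  have hst' : (s : ℝ) ≤ t := by exact_mod_cast hst
  have hC : 0 ≤ C := (abs_nonneg _).trans (hf 0)
  have hK := maxRate_nonneg (n := n) (lam := lam) hmu
  have hi1 := h.integrable_gen_frozen hmu hell hf s t
  have hi2 := h.integrable_gen hmu hell hf s t
  rw [intervalIntegral.integral_of_le hst', intervalIntegral.integral_of_le hst',
    ← integral_sub hi1.integral_prod_left hi2.integral_prod_left,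
    ← intervalIntegral.integral_of_le hst']
  have hbound : ∀ᵐ u : ℝ, u ∈ Set.uIoc (s : ℝ) t →
      ‖(∫ ω, gen lam mu f (X s ω, Z u.toNNReal ω) ∂P) -
        ∫ ω, gen lam mu f (X u.toNNReal ω, Z u.toNNReal ω) ∂P‖ ≤
      4 * C * maxRate n lam mu ^ 2 * ((t : ℝ) - s) := by
    rw [Set.uIoc_of_le hst', ← ae_restrict_iff' measurableSet_Ioc]
    filter_upwards [hi1.prod_right_ae, hi2.prod_right_ae, ae_restrict_mem measurableSet_Ioc]
      with u h1 h2 hu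
    have hu1 : s ≤ u.toNNReal := NNReal.le_toNNReal_of_coe_le hu.1.le
    have hu2 : u.toNNReal ≤ t := Real.toNNReal_le_iff_le_coe.2 hu.2
    rw [← integral_sub h1 h2]
    calc _ ≤ ∫ ω, 4 * C * maxRate n lam mu * ((∑ i, ((A u.toNNReal ω i - A s ω i) +
            (D u.toNNReal ω i - D s ω i)) : ℕ) : ℝ) ∂P := by
          refine norm_integral_le_of_norm_le ((h.integrable_total_sub hell hu1).const_mul _) ?_
          filter_upwards [h.service_le_servers hell, h.total_diff, h.eq_of_total_eq,
            h.simple] with ω hn ht hX hN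
          rw [ht _ _ hu1]
          have hmono := hN.mono hu1
          by_cases he : ∑ i, (A u.toNNReal ω i + D u.toNNReal ω i) =
              ∑ i, (A s ω i + D s ω i)
          · rw [hX _ _ hu1 he, he]; simp
          · have h1' : (1 : ℝ) ≤ ((∑ i, (A u.toNNReal ω i + D u.toNNReal ω i) -
                ∑ i, (A s ω i + D s ω i) : ℕ) : ℝ) := by
              exact_mod_cast (by omega)
            have b1 := abs_gen_le hmu hf (lam := lam) (s := (X s ω, Z u.toNNReal ω))
              fun i => hn _ _
            have b2 := abs_gen_le hmu hf (lam := lam) (s := (X u.toNNReal ω, Z u.toNNReal ω))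
              fun i => hn _ _
            refine (abs_sub _ _).trans ?_
            calc _ ≤ 4 * C * maxRate n lam mu * 1 := by linarith
              _ ≤ _ := by gcongr
      _ ≤ 4 * C * maxRate n lam mu * (maxRate n lam mu * (u.toNNReal - s)) := by
          rw [integral_const_mul]
          gcongr
          exact h.integral_total_sub_le hmu hell hu1
      _ ≤ 4 * C * maxRate n lam mu * (maxRate n lam mu * (t - s)) := by
          have : (u.toNNReal : ℝ) ≤ t := by exact_mod_cast hu2
          gcongr
      _ = _ := by ring
  have := intervalIntegral.norm_integral_le_of_norm_le_const_ae hbound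
  rw [abs_of_nonneg (sub_nonneg.2 hst')] at this
  refine (le_of_eq_of_le ?_ this).trans_eq (by ring)
  rfl

lemma measurable_jumps (h : IsProcess n lam ell mu P ℱ X Z A D) (t : ℝ≥0) :
    Measurable (jumps A D t) :=
  Finset.measurable_fun_sum _ fun i _ => ((measurable_pi_apply i).comp (h.measurable_A _)).add
    ((measurable_pi_apply i).comp (h.measurable_D _))

lemma aestronglyMeasurable_multiJump (h : IsProcess n lam ell mu P ℱ X Z A D) (s t : ℝ≥0) :
    AEStronglyMeasurable (fun ω => multiJump (jumps A D t ω - jumps A D s ω)) P :=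
  (Measurable.comp (g := multiJump) Measurable.of_discrete
    ((h.measurable_jumps t).sub (h.measurable_jumps s))).aestronglyMeasurable

lemma integrable_multiJump (h : IsProcess n lam ell mu P ℱ X Z A D) [IsProbabilityMeasure P]
    (hell : ∀ i, 0 < ell i) {s t : ℝ≥0} (hst : s ≤ t) :
    Integrable (fun ω => multiJump (jumps A D t ω - jumps A D s ω)) P := by
  refine (h.integrable_total_sub hell hst).mono' (h.aestronglyMeasurable_multiJump s t) ?_
  filter_upwards [h.total_diff] with ω hω
  rw [Real.norm_of_nonneg (multiJump_nonneg _), hω s t hst]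
  exact multiJump_le _

lemma integrable_jumps (h : IsProcess n lam ell mu P ℱ X Z A D) [IsProbabilityMeasure P]
    (hell : ∀ i, 0 < ell i) (T : ℝ≥0) : Integrable (fun ω => (jumps A D T ω : ℝ)) P := by
  refine (h.integrable_total_sub hell (zero_le : 0 ≤ T)).congr ?_
  filter_upwards [h.counts_zero] with ω hω
  simp [jumps, (hω _).1, (hω _).2]

lemma abs_dynkin_local_le (h : IsProcess n lam ell mu P ℱ X Z A D) [IsProbabilityMeasure P]
    (hmu : ∀ i, 0 < mu i) (hell : ∀ i, 0 < ell i) {f : (Fin I → ℕ) → ℝ} {C : ℝ}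
    (hf : ∀ x, |f x| ≤ C) {s t : ℝ≥0} (hst : s ≤ t) :
    |(∫ ω, f (X t ω) ∂P) - (∫ ω, f (X s ω) ∂P) -
      ∫ u in (s : ℝ)..t, ∫ ω, gen lam mu f (X u.toNNReal ω, Z u.toNNReal ω) ∂P| ≤
      3 * C * (∫ ω, multiJump (jumps A D t ω - jumps A D s ω) ∂P) +
      4 * C * maxRate n lam mu ^ 2 * ((t : ℝ) - s) ^ 2 := by
  obtain ⟨hi, he⟩ := h.integral_expansion hell hf hst
  have hfi : ∀ t, Integrable (fun ω => f (X t ω)) P := fun t =>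
    Integrable.of_bound ((Measurable.of_discrete (f := f)).comp
      (h.measurable_X t)).aestronglyMeasurable C (ae_of_all _ fun ω => hf _)
  have hfs : Integrable (fun ω => f (X t ω) - f (X s ω)) P := (hfi t).sub (hfi s)
  have hR : |(∫ ω, f (X t ω) ∂P) - (∫ ω, f (X s ω) ∂P) -
      ∫ u in (s : ℝ)..t, ∫ ω, gen lam mu f (X s ω, Z u.toNNReal ω) ∂P| ≤
      3 * C * (∫ ω, multiJump (jumps A D t ω - jumps A D s ω) ∂P) := by
    rw [← he, ← integral_sub (hfi t) (hfi s), ← integral_sub hfs hi, ← integral_const_mul]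
    rw [← Real.norm_eq_abs]
    refine norm_integral_le_of_norm_le ((h.integrable_multiJump hell hst).const_mul _) ?_
    filter_upwards [h.balance_diff, h.total_diff] with ω hb ht
    rw [jumps, jumps, ← ht s t hst]
    exact abs_sub_expansion_le hf _ _ _ _ (hb s t hst)
  have hF := h.abs_integral_gen_sub_le hmu hell hf hst
  exact (abs_sub_le _ _ _).trans (add_le_add hR hF)

/-- The local estimates summed over the partition of `[0, T]` into `m` equal pieces. -/
lemma abs_dynkin_partition_le (h : IsProcess n lam ell mu P ℱ X Z A D) [IsProbabilityMeasure P]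
    (hmu : ∀ i, 0 < mu i) (hell : ∀ i, 0 < ell i) {f : (Fin I → ℕ) → ℝ} {C : ℝ}
    (hf : ∀ x, |f x| ≤ C) (T : ℝ≥0) {m : ℕ} (hm : 0 < m) :
    |(∫ ω, f (X T ω) ∂P) - (∫ ω, f (X 0 ω) ∂P) -
      ∫ u in (0 : ℝ)..T, ∫ ω, gen lam mu f (X u.toNNReal ω, Z u.toNNReal ω) ∂P| ≤
      3 * C * (∫ ω, ∑ k ∈ Finset.range m, multiJump (jumps A D (T * (k + 1 : ℕ) / m) ω -
        jumps A D (T * k / m) ω) ∂P) + 4 * C * maxRate n lam mu ^ 2 * ((T : ℝ) ^ 2 / m) := by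
  have hm' : (m : ℝ≥0) ≠ 0 := by positivity
  have hmr : (m : ℝ) ≠ 0 := by positivity
  obtain ⟨t, ht⟩ : ∃ t : ℕ → ℝ≥0, ∀ k, t k = T * k / m := ⟨_, fun _ => rfl⟩
  have htm : t m = T := by rw [ht]; exact mul_div_cancel_right₀ _ hm'
  have ht0 : t 0 = 0 := by simp [ht]
  have htmono : ∀ k, t k ≤ t (k + 1) := fun k => by
    rw [ht, ht]; gcongr; exact Nat.le_succ k
  simp only [← ht]
  have e1 : (∫ ω, f (X T ω) ∂P) - (∫ ω, f (X 0 ω) ∂P) = ∑ k ∈ Finset.range m,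
      ((∫ ω, f (X (t (k + 1)) ω) ∂P) - (∫ ω, f (X (t k) ω) ∂P)) := by
    rw [Finset.sum_range_sub (fun k => ∫ ω, f (X (t k) ω) ∂P), htm, ht0]
  have e2 := intervalIntegral.sum_integral_adjacent_intervals (a := fun k => (t k : ℝ)) (n := m)
    (μ := volume) (f := fun u : ℝ => ∫ ω, gen lam mu f (X u.toNNReal ω, Z u.toNNReal ω) ∂P) (fun k _ => h.intervalIntegrable_gen hmu hell hf (htmono k))
  rw [htm, ht0, NNReal.coe_zero] at e2
  rw [e1, ← e2, ← Finset.sum_sub_distrib]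
  refine (Finset.abs_sum_le_sum_abs _ _).trans ((Finset.sum_le_sum fun k _ =>
    h.abs_dynkin_local_le hmu hell hf (htmono k)).trans_eq ?_)
  have e3 : ∀ k ∈ Finset.range m, ((t (k + 1) : ℝ) - t k) ^ 2 = (T / m) ^ 2 := fun k _ => by
    rw [ht, ht]; push_cast; congr 1; field_simp; ring
  rw [Finset.sum_add_distrib, ← Finset.mul_sum, ← Finset.mul_sum, Finset.sum_congr rfl e3,
    Finset.sum_const, Finset.card_range, nsmul_eq_mul,
    integral_finsetSum _ fun k _ => h.integrable_multiJump hell (htmono k)]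
  congr 2
  field_simp

/-- **Dynkin's formula** for bounded functions of the state. -/
theorem dynkin (h : IsProcess n lam ell mu P ℱ X Z A D) [IsProbabilityMeasure P]
    (hmu : ∀ i, 0 < mu i) (hell : ∀ i, 0 < ell i) {f : (Fin I → ℕ) → ℝ} {C : ℝ}
    (hf : ∀ x, |f x| ≤ C) (T : ℝ≥0) :
    (∫ ω, f (X T ω) ∂P) - (∫ ω, f (X 0 ω) ∂P) =
      ∫ u in (0 : ℝ)..T, ∫ ω, gen lam mu f (X u.toNNReal ω, Z u.toNNReal ω) ∂P := by
  have h1 : Tendsto (fun m : ℕ => ∫ ω, ∑ k ∈ Finset.range m,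
      multiJump (jumps A D (T * (k + 1 : ℕ) / m) ω - jumps A D (T * k / m) ω) ∂P) atTop
      (𝓝 (∫ _, (0 : ℝ) ∂P)) := by
    refine tendsto_integral_filter_of_dominated_convergence (fun ω => (jumps A D T ω : ℝ)) ?_ ?_
      (h.integrable_jumps hell T) ?_
    · exact Eventually.of_forall fun m => Finset.aestronglyMeasurable_fun_sum _ fun k _ =>
        h.aestronglyMeasurable_multiJump _ _
    · filter_upwards [eventually_gt_atTop 0] with m hm
      filter_upwards [h.simple] with ω hω
      rw [Real.norm_of_nonneg (Finset.sum_nonneg fun k _ => multiJump_nonneg _)]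
      exact sum_multiJump_le (N := fun t => jumps A D t ω) hω.mono T hm
    · filter_upwards [h.simple] with ω hω
      exact tendsto_const_nhds.congr' ((IsCountingPath.eventually_sum_multiJump
        (N := fun t => jumps A D t ω) hω T).mono fun m hm => hm.symm)
  have h2 : Tendsto (fun m : ℕ => (T : ℝ) ^ 2 / m) atTop (𝓝 0) :=
    tendsto_const_div_atTop_nhds_zero_nat _
  have h3 := (h1.const_mul (3 * C)).add (h2.const_mul (4 * C * maxRate n lam mu ^ 2))
  rw [integral_zero, mul_zero, mul_zero, add_zero] at h3
  exact sub_eq_zero.1 (abs_nonpos_iff.1 (ge_of_tendsto h3 ((eventually_gt_atTop 0).mono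
    fun m hm => h.abs_dynkin_partition_le hmu hell hf T hm)))

end IsProcess

variable {π : Measure ((Fin I → ℕ) × (Fin I → ℕ))}

/-! ### The adjoint relation for steady-state distributions -/

/-- `π` is a law on states `(x, z)` that respects the service constraints and satisfies the basic
adjoint relation: the drift of every bounded function of `x` has mean zero.  All that the lower
bound uses about a steady-state distribution is collected here. -/
structure IsAdjointLaw (n : ℕ) (lam : Fin I → ℝ≥0) (ell : Fin I → ℕ) (mu : Fin I → ℝ)
    (π : Measure ((Fin I → ℕ) × (Fin I → ℕ))) : Prop where
  prob : IsProbabilityMeasure π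
  service_le : ∀ᵐ s ∂π, ∀ i, s.2 i ≤ s.1 i
  capacity : ∀ᵐ s ∂π, ∑ i, ell i * s.2 i ≤ n
  adjoint : ∀ (f : (Fin I → ℕ) → ℝ) (C : ℝ), (∀ x, |f x| ≤ C) → ∫ s, gen lam mu f s ∂π = 0

lemma tendsto_gen {f : ℕ → (Fin I → ℕ) → ℝ} {g : (Fin I → ℕ) → ℝ}
    (hf : ∀ x, Tendsto (fun m => f m x) atTop (𝓝 (g x))) (s : (Fin I → ℕ) × (Fin I → ℕ)) :
    Tendsto (fun m => gen lam mu (f m) s) atTop (𝓝 (gen lam mu g s)) :=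
  tendsto_finsetSum _ fun _ _ => (((hf _).sub (hf _)).const_mul _).add
    (((hf _).sub (hf _)).const_mul _)

/-- The adjoint relation passes to pointwise limits with dominated drifts. -/
lemma integral_gen_eq_zero_of_tendsto {f : ℕ → (Fin I → ℕ) → ℝ} {g : (Fin I → ℕ) → ℝ}
    (hf : ∀ x, Tendsto (fun m => f m x) atTop (𝓝 (g x)))
    (h0 : ∀ m, ∫ s, gen lam mu (f m) s ∂π = 0) {B : (Fin I → ℕ) × (Fin I → ℕ) → ℝ}
    (hB : Integrable B π) (hfB : ∀ m, ∀ᵐ s ∂π, |gen lam mu (f m) s| ≤ B s) :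
    ∫ s, gen lam mu g s ∂π = 0 := by
  have := tendsto_integral_of_dominated_convergence B
    (fun m => (Measurable.of_discrete (f := gen lam mu (f m))).aestronglyMeasurable (μ := π))
    hB hfB (ae_of_all _ fun s => tendsto_gen hf s)
  simp only [h0] at this
  exact (tendsto_nhds_unique this tendsto_const_nhds)

lemma gen_eq_zero_of_not_le {f : (Fin I → ℕ) → ℝ} {M : ℕ}
    (hf : ∀ x : Fin I → ℕ, ¬ (∀ i, x i ≤ M) → f x = 0) {s : (Fin I → ℕ) × (Fin I → ℕ)}
    (hs : ¬ ∀ i, s.1 i ≤ M + 1) : gen lam mu f s = 0 := by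
  push Not at hs
  obtain ⟨j, hj⟩ := hs
  refine Finset.sum_eq_zero fun i _ => ?_
  have h0 : f s.1 = 0 := hf _ fun hc => by have := hc j; omega
  have h1 : f (s.1 + Pi.single i 1) = 0 := hf _ fun hc => by
    have := hc j
    simp only [Pi.add_apply] at this
    omega
  have h2 : f (s.1 - Pi.single i 1) = 0 := hf _ fun hc => by
    have := hc j
    have h3 : (Pi.single i 1 : Fin I → ℕ) j ≤ 1 := by
      by_cases hji : j = i
      · subst hji; simp
      · simp [hji]
    simp only [Pi.sub_apply] at this
    omega
  rw [h0, h1, h2]; simp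

lemma sum_mul_indicator_eq {α : Type*} [DecidableEq α] {F : Finset α} {G : α → ℝ}
    (hG : ∀ s, s ∉ F → G s = 0) (y : α) :
    ∑ s ∈ F, G s * (({s} : Set α).indicator (fun _ => (1 : ℝ)) y) = G y := by
  by_cases hy : y ∈ F
  · rw [Finset.sum_eq_single y]
    · simp
    · intro s _ hs; simp [hs.symm]
    · exact fun h => absurd hy h
  · rw [hG y hy]
    refine Finset.sum_eq_zero fun s hs => ?_
    have : y ≠ s := fun e => hy (e ▸ hs)
    simp [this]

lemma IsProcess.measurable_Z (h : IsProcess n lam ell mu P ℱ X Z A D) (t : ℝ≥0) :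
    Measurable (Z t) :=
  ((h.progressive_Z.stronglyAdapted t).measurable).mono (ℱ.le t) le_rfl

namespace IsSteadyState

lemma measure_eq_zero (hπ : IsSteadyState P X Z π) {s : (Fin I → ℕ) × (Fin I → ℕ)}
    (hs : ∀ t, P {ω | X t ω = s.1 ∧ Z t ω = s.2} = 0) : π {s} = 0 := by
  have hp := hπ.prob
  have := hπ.average s.1 s.2
  simp only [measureReal_def, hs, ENNReal.toReal_zero, intervalIntegral.integral_zero,
    mul_zero] at this
  have h0 := tendsto_nhds_unique this tendsto_const_nhds
  rw [ENNReal.toReal_eq_zero_iff] at h0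
  exact h0.resolve_right (measure_ne_top _ _)

lemma ae_service_le (hπ : IsSteadyState P X Z π) (h : IsProcess n lam ell mu P ℱ X Z A D) :
    ∀ᵐ s ∂π, ∀ i, s.2 i ≤ s.1 i := by
  rw [ae_iff_of_countable]
  intro s hs
  by_contra hc
  refine hs (hπ.measure_eq_zero fun t => measure_mono_null ?_ (ae_iff.1 h.service_le))
  rintro ω ⟨h1, h2⟩ hω
  exact hc (h1 ▸ h2 ▸ hω t)

lemma ae_capacity (hπ : IsSteadyState P X Z π) (h : IsProcess n lam ell mu P ℱ X Z A D) :
    ∀ᵐ s ∂π, ∑ i, ell i * s.2 i ≤ n := by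
  rw [ae_iff_of_countable]
  intro s hs
  by_contra hc
  refine hs (hπ.measure_eq_zero fun t => measure_mono_null ?_ (ae_iff.1 h.capacity))
  rintro ω ⟨h1, h2⟩ hω
  exact hc (h2 ▸ hω t)

variable [IsProbabilityMeasure P]

/-- The adjoint relation for functions supported in a finite box: divide Dynkin's formula by the
length of the time interval, and use that only finitely many states contribute. -/
lemma integral_gen_of_box (hπ : IsSteadyState P X Z π) (h : IsProcess n lam ell mu P ℱ X Z A D)
    (hmu : ∀ i, 0 < mu i) (hell : ∀ i, 0 < ell i) {f : (Fin I → ℕ) → ℝ} {C : ℝ}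
    (hf : ∀ x, |f x| ≤ C) {M : ℕ} (hM : ∀ x : Fin I → ℕ, ¬ (∀ i, x i ≤ M) → f x = 0) :
    ∫ s, gen lam mu f s ∂π = 0 := by
  classical
  have hp := hπ.prob
  let F : Finset ((Fin I → ℕ) × (Fin I → ℕ)) :=
    Finset.Iic (fun _ => M + 1) ×ˢ Finset.Iic (fun _ => M + 1)
  let G : (Fin I → ℕ) × (Fin I → ℕ) → ℝ := fun s =>
    if ∀ i, s.2 i ≤ s.1 i then gen lam mu f s else 0
  have hGF : ∀ s, s ∉ F → G s = 0 := by
    intro s hs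
    simp only [G]
    split_ifs with hz
    · refine gen_eq_zero_of_not_le hM fun hc => hs ?_
      simp only [F, Finset.mem_product, Finset.mem_Iic]
      exact ⟨hc, fun i => (hz i).trans (hc i)⟩
    · rfl
  have hind : ∀ (s : (Fin I → ℕ) × (Fin I → ℕ)) (u : ℝ),
      ∫ ω, ({s} : Set _).indicator (fun _ => (1 : ℝ)) (X u.toNNReal ω, Z u.toNNReal ω) ∂P =
        P.real {ω | X u.toNNReal ω = s.1 ∧ Z u.toNNReal ω = s.2} := by
    intro s u
    have hm : MeasurableSet {ω | X u.toNNReal ω = s.1 ∧ Z u.toNNReal ω = s.2} :=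
      ((h.measurable_X _) (measurableSet_singleton s.1)).inter
        ((h.measurable_Z _) (measurableSet_singleton s.2))
    rw [← integral_indicator_one hm]
    refine integral_congr_ae (ae_of_all _ fun ω => ?_)
    simp [Set.indicator_apply, Prod.ext_iff]
  have hprod : ∀ (s : (Fin I → ℕ) × (Fin I → ℕ)) (T : ℝ≥0), Integrable (fun p : ℝ × Ω =>
      ({s} : Set _).indicator (fun _ => (1 : ℝ)) (X p.1.toNNReal p.2, Z p.1.toNNReal p.2))
      ((volume.restrict (Set.Ioc ((0 : ℝ≥0) : ℝ) T)).prod P) := by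
    intro s T
    refine Integrable.of_bound (C := 1) ((Measurable.of_discrete
      (f := ({s} : Set _).indicator (fun _ => (1 : ℝ)))).comp_aemeasurable
      ((h.aemeasurable_X _).prodMk (h.aemeasurable_Z 0 T))).aestronglyMeasurable
      (ae_of_all _ fun p => ?_)
    exact (norm_indicator_le_norm_self _ _).trans (by simp)
  have hdrift : ∀ T : ℝ≥0, ∫ u in (0 : ℝ)..T, ∫ ω, gen lam mu f
      (X u.toNNReal ω, Z u.toNNReal ω) ∂P = ∑ s ∈ F, G s * ∫ u in (0 : ℝ)..T,
        P.real {ω | X u.toNNReal ω = s.1 ∧ Z u.toNNReal ω = s.2} := by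
    intro T
    have e1 : ∀ u : ℝ, ∫ ω, gen lam mu f (X u.toNNReal ω, Z u.toNNReal ω) ∂P =
        ∫ ω, ∑ s ∈ F, G s * ({s} : Set _).indicator (fun _ => (1 : ℝ))
          (X u.toNNReal ω, Z u.toNNReal ω) ∂P := by
      intro u
      refine integral_congr_ae ?_
      filter_upwards [h.service_le] with ω hω
      rw [sum_mul_indicator_eq hGF]
      exact (if_pos (hω _)).symm
    simp only [e1]
    rw [intervalIntegral.integral_of_le T.coe_nonneg]
    have := integral_integral_finsetSum (P := P) F
      (ν := volume.restrict (Set.Ioc ((0 : ℝ≥0) : ℝ) T)) (p := fun s p => G s *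
        ({s} : Set _).indicator (fun _ => (1 : ℝ)) (X p.1.toNNReal p.2, Z p.1.toNNReal p.2))
      (fun s _ => (hprod s T).const_mul _)
    rw [NNReal.coe_zero] at this
    rw [this]
    refine Finset.sum_congr rfl fun s _ => ?_
    rw [intervalIntegral.integral_of_le T.coe_nonneg, ← integral_const_mul]
    refine integral_congr_ae (ae_of_all _ fun u => ?_)
    simp only
    rw [integral_const_mul, hind]
  have hlim1 : Tendsto (fun T : ℝ => ∑ s ∈ F, G s * (T⁻¹ * ∫ u in (0 : ℝ)..T,
      P.real {ω | X u.toNNReal ω = s.1 ∧ Z u.toNNReal ω = s.2})) atTop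
      (𝓝 (∑ s ∈ F, G s * π.real {s})) :=
    tendsto_finsetSum _ fun s _ => (hπ.average s.1 s.2).const_mul _
  have hlim2 : Tendsto (fun T : ℝ => ∑ s ∈ F, G s * (T⁻¹ * ∫ u in (0 : ℝ)..T,
      P.real {ω | X u.toNNReal ω = s.1 ∧ Z u.toNNReal ω = s.2})) atTop (𝓝 0) := by
    have hlim : Tendsto (fun T : ℝ => T⁻¹ * (2 * C)) atTop (𝓝 0) := by
      simpa using tendsto_inv_atTop_zero.mul_const (2 * C)
    refine squeeze_zero_norm' ?_ hlim
    filter_upwards [eventually_gt_atTop 0] with T hT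
    have e : ∑ s ∈ F, G s * (T⁻¹ * ∫ u in (0 : ℝ)..T,
        P.real {ω | X u.toNNReal ω = s.1 ∧ Z u.toNNReal ω = s.2}) =
        T⁻¹ * ((∫ ω, f (X T.toNNReal ω) ∂P) - ∫ ω, f (X 0 ω) ∂P) := by
      rw [h.dynkin hmu hell hf, hdrift, Finset.mul_sum, Real.coe_toNNReal T hT.le]
      exact Finset.sum_congr rfl fun s _ => by ring
    rw [e, norm_mul, Real.norm_of_nonneg (inv_nonneg.2 hT.le)]
    gcongr
    have hb : ∀ t, ‖∫ ω, f (X t ω) ∂P‖ ≤ C := fun t => by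
      simpa using norm_integral_le_of_norm_le_const (μ := P) (f := fun ω => f (X t ω))
        (ae_of_all _ fun ω => hf (X t ω))
    exact (norm_sub_le _ _).trans (by linarith [hb T.toNNReal, hb 0])
  have hsum := tendsto_nhds_unique hlim1 hlim2
  rw [← hsum]
  have hGg : ∫ s, gen lam mu f s ∂π = ∫ s, ∑ s' ∈ F, G s' *
      ({s'} : Set _).indicator (fun _ => (1 : ℝ)) s ∂π := by
    refine integral_congr_ae ?_
    filter_upwards [hπ.ae_service_le h] with s hs
    rw [sum_mul_indicator_eq hGF]
    exact (if_pos hs).symm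
  rw [hGg, integral_finsetSum]
  · refine Finset.sum_congr rfl fun s _ => ?_
    rw [integral_const_mul, integral_indicator_const _ (measurableSet_singleton s), smul_eq_mul,
      mul_one]
  · intro s _
    exact (Integrable.indicator (integrable_const _) (measurableSet_singleton s)).const_mul _

theorem isAdjointLaw (hπ : IsSteadyState P X Z π) (h : IsProcess n lam ell mu P ℱ X Z A D)
    (hmu : ∀ i, 0 < mu i) (hell : ∀ i, 0 < ell i) : IsAdjointLaw n lam ell mu π where
  prob := hπ.prob
  service_le := hπ.ae_service_le h
  capacity := hπ.ae_capacity h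
  adjoint f C hf := by
    classical
    have hp := hπ.prob
    have hC : 0 ≤ C := (abs_nonneg _).trans (hf 0)
    have hb : ∀ (m : ℕ) (x : Fin I → ℕ), |if ∀ i, x i ≤ m then f x else 0| ≤ C := fun m x => by
      split_ifs
      · exact hf x
      · simpa using hC
    refine integral_gen_eq_zero_of_tendsto
      (f := fun m x => if ∀ i, x i ≤ m then f x else 0) (fun x => ?_)
      (fun m => hπ.integral_gen_of_box h hmu hell (hb m) (M := m) fun x hx => if_neg hx)
      (integrable_const (2 * C * maxRate n lam mu)) (fun m => ?_)
    · refine tendsto_const_nhds.congr' ?_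
      filter_upwards [eventually_ge_atTop (∑ i, x i)] with m hm
      exact (if_pos fun i => (Finset.single_le_sum (fun _ _ => Nat.zero_le _)
        (Finset.mem_univ i)).trans hm).symm
    · filter_upwards [hπ.ae_capacity h] with s hs
      refine abs_gen_le hmu (hb m) fun i => le_trans ?_ hs
      exact (Nat.le_mul_of_pos_left _ (hell i)).trans (Finset.single_le_sum
        (f := fun i => ell i * s.2 i) (fun _ _ => Nat.zero_le _) (Finset.mem_univ i))

end IsSteadyState

/-! ### Consequences of the adjoint relation for a single job type -/

lemma gen_comp_eval (i : Fin I) (φ : ℕ → ℝ) (s : (Fin I → ℕ) × (Fin I → ℕ)) :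
    gen lam mu (fun x => φ (x i)) s = (lam i : ℝ) * (φ (s.1 i + 1) - φ (s.1 i)) +
      mu i * s.2 i * (φ (s.1 i - 1) - φ (s.1 i)) := by
  rw [gen, Finset.sum_eq_single i]
  · simp
  · intro j _ hj
    simp [hj.symm]
  · simp

namespace IsAdjointLaw

lemma service_le_servers (h : IsAdjointLaw n lam ell mu π) (hell : ∀ i, 0 < ell i) :
    ∀ᵐ s ∂π, ∀ i, s.2 i ≤ n := by
  filter_upwards [h.capacity] with s hs i
  refine le_trans ?_ hs
  exact (Nat.le_mul_of_pos_left _ (hell i)).trans (Finset.single_le_sum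
    (f := fun i => ell i * s.2 i) (fun _ _ => Nat.zero_le _) (Finset.mem_univ i))

lemma integrable_service (h : IsAdjointLaw n lam ell mu π) (hell : ∀ i, 0 < ell i) (i : Fin I) :
    Integrable (fun s : (Fin I → ℕ) × (Fin I → ℕ) => (s.2 i : ℝ)) π := by
  have := h.prob
  refine Integrable.of_bound Measurable.of_discrete.aestronglyMeasurable n ?_
  filter_upwards [h.service_le_servers hell] with s hs
  rw [Real.norm_natCast]
  exact_mod_cast hs i

lemma integrable_gen (h : IsAdjointLaw n lam ell mu π) (hmu : ∀ i, 0 < mu i)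
    (hell : ∀ i, 0 < ell i) {f : (Fin I → ℕ) → ℝ} {C : ℝ} (hf : ∀ x, |f x| ≤ C) :
    Integrable (gen lam mu f) π := by
  have := h.prob
  refine Integrable.of_bound Measurable.of_discrete.aestronglyMeasurable
    (2 * C * maxRate n lam mu) ?_
  filter_upwards [h.service_le_servers hell] with s hs
  exact abs_gen_le hmu hf hs

/-- Flow balance: in steady state the mean number of jobs in service is the offered load. -/
lemma integral_service (h : IsAdjointLaw n lam ell mu π) (hmu : ∀ i, 0 < mu i)
    (hell : ∀ i, 0 < ell i) (i : Fin I) : mu i * ∫ s, (s.2 i : ℝ) ∂π = lam i := by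
  have hp := h.prob
  have h0 : ∫ s, gen lam mu (fun x => (x i : ℝ)) s ∂π = 0 := by
    refine integral_gen_eq_zero_of_tendsto (f := fun (m : ℕ) x => min (x i : ℝ) m) (fun x => ?_)
      (fun m => h.adjoint _ m fun x => ?_)
      (integrable_const ((lam i : ℝ) + mu i * n)) (fun m => ?_)
    · refine tendsto_const_nhds.congr' ?_
      filter_upwards [eventually_ge_atTop (x i)] with m hm
      exact (min_eq_left (by exact_mod_cast hm)).symm
    · rw [abs_of_nonneg (by positivity)]
      exact min_le_right _ _
    · filter_upwards [h.service_le_servers hell] with s hs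
      rw [gen_comp_eval i (fun k => min (k : ℝ) m)]
      have h1 : |min ((s.1 i + 1 : ℕ) : ℝ) m - min ((s.1 i : ℕ) : ℝ) m| ≤ 1 := by
        refine (abs_min_sub_min_le_max _ _ _ _).trans ?_
        simp
      have h2 : |min ((s.1 i - 1 : ℕ) : ℝ) m - min ((s.1 i : ℕ) : ℝ) m| ≤ 1 := by
        refine (abs_min_sub_min_le_max _ _ _ _).trans ?_
        rcases Nat.eq_zero_or_pos (s.1 i) with h0 | h0
        · simp [h0]
        · rw [Nat.cast_sub h0]; simp
      have h3 : (s.2 i : ℝ) ≤ n := by exact_mod_cast hs i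
      have h4 := hmu i
      refine (abs_add_le _ _).trans ?_
      rw [abs_mul, abs_mul, abs_of_nonneg (lam i).coe_nonneg,
        abs_of_nonneg (show 0 ≤ mu i * (s.2 i : ℝ) by positivity)]
      have h5 : mu i * (s.2 i : ℝ) * |min ((s.1 i - 1 : ℕ) : ℝ) m - min ((s.1 i : ℕ) : ℝ) m| ≤
          mu i * n * 1 := by gcongr
      have h6 : (lam i : ℝ) * |min ((s.1 i + 1 : ℕ) : ℝ) m - min ((s.1 i : ℕ) : ℝ) m| ≤
          lam i * 1 := by gcongr
      linarith
  have h1 : ∫ s, gen lam mu (fun x => (x i : ℝ)) s ∂π =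
      ∫ s, ((lam i : ℝ) - mu i * s.2 i) ∂π := by
    refine integral_congr_ae ?_
    filter_upwards [h.service_le] with s hs
    rw [gen_comp_eval i (fun k => (k : ℝ))]
    have := hs i
    rcases Nat.eq_zero_or_pos (s.1 i) with h0 | h0
    · rw [show s.2 i = 0 by omega]; simp
    · rw [Nat.cast_sub h0]; push_cast; ring
  rw [h0, integral_sub (integrable_const _) ((h.integrable_service hell i).const_mul _),
    integral_const_mul] at h1
  simp at h1
  linarith

/-- Since at most `k + 1` jobs are served when `x i = k + 1`, the law of `x i` is at least as
spread out to the right as that of an infinite-server queue. -/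
lemma measure_eq_le_succ (h : IsAdjointLaw n lam ell mu π) (hmu : ∀ i, 0 < mu i)
    (hell : ∀ i, 0 < ell i) (i : Fin I) (k : ℕ) : (lam i : ℝ) * π.real {s | s.1 i = k} ≤
      mu i * (k + 1) * π.real {s | s.1 i = k + 1} := by
  have hp := h.prob
  have hm : ∀ k : ℕ, MeasurableSet {s : (Fin I → ℕ) × (Fin I → ℕ) | s.1 i = k} :=
    fun k => MeasurableSet.of_discrete
  have h0 := h.adjoint (fun x => if k < x i then 1 else 0) 1 (fun x => by split_ifs <;> simp)
  have hi : ∀ (k : ℕ) (c : ℝ), Integrable (fun s : (Fin I → ℕ) × (Fin I → ℕ) =>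
      c * {s : (Fin I → ℕ) × (Fin I → ℕ) | s.1 i = k}.indicator (fun _ => (1 : ℝ)) s) π :=
    fun k c => (Integrable.indicator (integrable_const _) (hm k)).const_mul _
  have hle : ∫ s, ((lam i : ℝ) * {s : (Fin I → ℕ) × (Fin I → ℕ) | s.1 i = k}.indicator
        (fun _ => (1 : ℝ)) s - mu i * (k + 1) *
        {s : (Fin I → ℕ) × (Fin I → ℕ) | s.1 i = k + 1}.indicator (fun _ => (1 : ℝ)) s) ∂π ≤
      ∫ s, gen lam mu (fun x => if k < x i then 1 else 0) s ∂π := by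
    refine integral_mono_ae ((hi _ _).sub (hi _ _))
      (h.integrable_gen hmu hell (C := 1) fun x => by split_ifs <;> simp) ?_
    filter_upwards [h.service_le] with s hs
    rw [gen_comp_eval i (fun j => if k < j then (1 : ℝ) else 0)]
    have h1 : (s.2 i : ℝ) ≤ s.1 i := by exact_mod_cast hs i
    have h2 := hmu i
    simp only [Set.indicator_apply, Set.mem_ofPred_eq]
    rcases lt_trichotomy (s.1 i) k with hlt | heq | hgt
    · simp [show ¬ k < s.1 i + 1 by omega, show ¬ k < s.1 i by omega, hlt.ne,
        show ¬ k < s.1 i - 1 by omega, show s.1 i ≠ k + 1 by omega]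
    · simp [heq, show ¬ k < k - 1 by omega]
    · by_cases he : s.1 i = k + 1
      · simp only [he, show k + 1 ≠ k by omega]
        simp only [if_false, if_true, show k < k + 1 + 1 by omega, show k < k + 1 by omega,
          show ¬ k < k + 1 - 1 by omega]
        rw [he] at h1
        push_cast at h1
        have : mu i * (s.2 i : ℝ) ≤ mu i * (k + 1) := by gcongr
        linarith
      · simp [show k < s.1 i + 1 by omega, hgt, hgt.ne', he, show k < s.1 i - 1 by omega]
  rw [h0, integral_sub (hi _ _) (hi _ _), integral_const_mul, integral_const_mul,
    integral_indicator_const _ (hm _), integral_indicator_const _ (hm _)] at hle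
  simp only [smul_eq_mul, mul_one] at hle
  linarith

/-- As long as `k + m ≤ r ρ`, each of `m` steps of the recursion from `k` gains a factor `r`. -/
lemma measure_eq_le_pow (h : IsAdjointLaw n lam ell mu π) (hmu : ∀ i, 0 < mu i)
    (hell : ∀ i, 0 < ell i) (i : Fin I) {r : ℝ} (hr : 0 ≤ r) (hlam : 0 < lam i) (k m : ℕ)
    (hkm : ((k + m : ℕ) : ℝ) ≤ r * (lam i / mu i)) :
    π.real {s | s.1 i = k} ≤ r ^ m := by
  have hp := h.prob
  have hl : (0 : ℝ) < lam i := hlam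
  have hm := hmu i
  induction m generalizing k with
  | zero => simp
  | succ m ih =>
    have h1 := ih (k + 1) (by convert hkm using 2; omega)
    have h2 := h.measure_eq_le_succ hmu hell i k
    have h3 : mu i * (k + 1) ≤ r * lam i := by
      have : ((k : ℝ) + 1) ≤ r * (lam i / mu i) := by
        refine le_trans ?_ hkm; push_cast; linarith [(Nat.cast_nonneg m : (0 : ℝ) ≤ m)]
      calc mu i * (k + 1) ≤ mu i * (r * (lam i / mu i)) := by gcongr
        _ = _ := by field_simp
    have h4 : (lam i : ℝ) * π.real {s | s.1 i = k} ≤ lam i * (r ^ (m + 1)) := by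
      calc _ ≤ _ := h2
        _ ≤ r * lam i * r ^ m := by gcongr
        _ = _ := by ring
    exact le_of_mul_le_mul_left h4 hl

/-- Poisson-type lower tail of the number of type-`i` jobs: falling `2 L √ρ` below the offered load
`ρ` has Gaussian-small probability. -/
lemma measure_lower_tail_le (h : IsAdjointLaw n lam ell mu π) (hmu : ∀ i, 0 < mu i)
    (hell : ∀ i, 0 < ell i) (i : Fin I) {L : ℝ} (hL : 1 ≤ L) :
    π.real {s | (s.1 i : ℝ) + 2 * (√((lam i : ℝ) / mu i) * L) < lam i / mu i} ≤
      ((lam i : ℝ) / mu i + 1) * Real.exp (1 / 2 - L ^ 2) := by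
  have hp := h.prob
  have hm := hmu i
  set ρ : ℝ := (lam i : ℝ) / mu i with hρ
  set y : ℝ := √ρ * L with hy
  have hρ0 : 0 ≤ ρ := by positivity
  have hy0 : 0 ≤ y := by positivity
  have hpt : ∀ k : ℕ, (k : ℝ) + 2 * y < ρ →
      π.real {s | s.1 i = k} ≤ Real.exp (1 / 2 - L ^ 2) := by
    intro k hk
    have hρpos : 0 < ρ := by
      have : (0 : ℝ) ≤ k := Nat.cast_nonneg k
      linarith
    have hlam : 0 < lam i := by
      rw [pos_iff_ne_zero]; intro h0; rw [hρ, h0] at hρpos; simp at hρpos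
    have hsq : √ρ * √ρ = ρ := Real.mul_self_sqrt hρ0
    have hs0 : 0 < √ρ := Real.sqrt_pos.2 hρpos
    have hyρ : 2 * y < ρ := by have : (0 : ℝ) ≤ k := Nat.cast_nonneg k; linarith
    have h2L : 2 * L < √ρ := by
      rw [hy, ← hsq] at hyρ
      nlinarith
    have hr : 0 ≤ 1 - y / ρ := by
      rw [sub_nonneg, div_le_one hρpos]; linarith
    -- `⌊y⌋` steps up from `k` stay below `ρ - y`, so each gains the factor `1 - y / ρ`
    refine (h.measure_eq_le_pow hmu hell i hr hlam k ⌊y⌋₊ ?_).trans ?_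
    · rw [← hρ, sub_mul, one_mul, div_mul_cancel₀ _ hρpos.ne']
      push_cast
      have := Nat.floor_le hy0
      linarith
    · have h1 : 1 - y / ρ ≤ Real.exp (-(y / ρ)) := by
        have := Real.add_one_le_exp (-(y / ρ)); linarith
      calc (1 - y / ρ) ^ ⌊y⌋₊ ≤ Real.exp (-(y / ρ)) ^ ⌊y⌋₊ := by gcongr
        _ = Real.exp (-(⌊y⌋₊ * (y / ρ))) := by rw [← Real.exp_nat_mul]; ring_nf
        _ ≤ Real.exp (1 / 2 - L ^ 2) := by
          rw [Real.exp_le_exp]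
          have h2 := Nat.lt_floor_add_one y
          have h3 : y / ρ * y = L ^ 2 := by
            rw [hy]; field_simp; rw [Real.sq_sqrt hρ0]
          have h4 : y / ρ ≤ 1 / 2 := by rw [div_le_iff₀ hρpos]; linarith
          have h5 : (y - 1) * (y / ρ) ≤ ⌊y⌋₊ * (y / ρ) := by
            gcongr; linarith
          linarith
  have hsub : {s : (Fin I → ℕ) × (Fin I → ℕ) | (s.1 i : ℝ) + 2 * y < ρ} ⊆
      ⋃ k ∈ (Finset.range ⌈ρ⌉₊).filter (fun k : ℕ => (k : ℝ) + 2 * y < ρ), {s | s.1 i = k} := by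
    intro s hs
    simp only [Set.mem_ofPred_eq] at hs
    simp only [Set.mem_iUnion, Finset.mem_filter, Finset.mem_range, Set.mem_ofPred_eq, exists_prop]
    exact ⟨s.1 i, ⟨Nat.lt_ceil.2 (by linarith), hs⟩, rfl⟩
  calc _ ≤ _ := measureReal_mono hsub (measure_ne_top _ _)
    _ ≤ _ := measureReal_biUnion_finset_le _ _
    _ ≤ ∑ k ∈ (Finset.range ⌈ρ⌉₊).filter (fun k : ℕ => (k : ℝ) + 2 * y < ρ),
        Real.exp (1 / 2 - L ^ 2) :=
      Finset.sum_le_sum fun k hk => hpt k (Finset.mem_filter.1 hk).2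
    _ ≤ ∑ k ∈ Finset.range ⌈ρ⌉₊, Real.exp (1 / 2 - L ^ 2) :=
      Finset.sum_le_sum_of_subset_of_nonneg (Finset.filter_subset _ _)
        fun _ _ _ => (Real.exp_pos _).le
    _ ≤ _ := by
      rw [Finset.sum_const, Finset.card_range, nsmul_eq_mul]
      gcongr
      exact (Nat.ceil_lt_add_one hρ0).le

end IsAdjointLaw

/-! ### The quadratic drift identity -/

/-- The total work `∑ᵢ (ℓᵢ / μᵢ) xᵢ` of the jobs in the system, in service or not. -/
noncomputable def work (ell : Fin I → ℕ) (mu : Fin I → ℝ) (x : Fin I → ℕ) : ℝ := ∑ i, (ell i : ℝ) / mu i * x i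

/-- The number of idle servers. -/
noncomputable def idle (n : ℕ) (ell : Fin I → ℕ) (z : Fin I → ℕ) : ℝ := n - ∑ i, (ell i : ℝ) * z i

lemma work_nonneg (hmu : ∀ i, 0 < mu i) (x : Fin I → ℕ) : 0 ≤ work ell mu x :=
  Finset.sum_nonneg fun i _ => by have := hmu i; positivity

lemma work_add_single (x : Fin I → ℕ) (i : Fin I) :
    work ell mu (x + Pi.single i 1) = work ell mu x + (ell i : ℝ) / mu i := by
  simp only [work, Pi.add_apply, Nat.cast_add, mul_add, Finset.sum_add_distrib]
  congr 1
  rw [Finset.sum_eq_single i] <;> simp +contextual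

lemma work_sub_single {x : Fin I → ℕ} {i : Fin I} (hx : 0 < x i) :
    work ell mu (x - Pi.single i 1) = work ell mu x - (ell i : ℝ) / mu i := by
  have h : x = (x - Pi.single i 1) + Pi.single i 1 := by
    ext j
    by_cases hj : j = i
    · subst hj; simp; omega
    · simp [hj]
  conv_rhs => rw [h, work_add_single]
  ring

lemma gen_work_sq (hmu : ∀ i, 0 < mu i) {s : (Fin I → ℕ) × (Fin I → ℕ)}
    (hs : ∀ i, s.2 i ≤ s.1 i) :
    gen lam mu (fun x => work ell mu x ^ 2) s =
      2 * (work ell mu s.1 * (idle n ell s.2 - slack n lam ell mu)) +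
        ∑ i, ((ell i : ℝ) / mu i) ^ 2 * (lam i + mu i * s.2 i) := by
  have h1 : idle n ell s.2 - slack n lam ell mu =
      ∑ i, ((lam i : ℝ) * ell i / mu i - ell i * s.2 i) := by
    rw [idle, slack, Finset.sum_sub_distrib]; ring
  rw [h1, ← mul_assoc, Finset.mul_sum, ← Finset.sum_add_distrib, gen]
  refine Finset.sum_congr rfl fun i _ => ?_
  have hm := (hmu i).ne'
  rw [work_add_single]
  rcases Nat.eq_zero_or_pos (s.2 i) with h0 | h0
  · rw [h0]; field_simp; ring
  · rw [work_sub_single (lt_of_lt_of_le h0 (hs i))]; field_simp; ring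

lemma abs_min_sq_sub_le {w w' m a : ℝ} (hw : 0 ≤ w) (hw' : 0 ≤ w') (hm : 0 ≤ m)
    (h : |w' - w| ≤ a) : |min w' m ^ 2 - min w m ^ 2| ≤ a * (2 * w + a) := by
  have h1 : |min w' m - min w m| ≤ a :=
    (abs_min_sub_min_le_max _ _ _ _).trans (by simpa using h)
  have h2 : |min w' m + min w m| ≤ 2 * w + a := by
    rw [abs_of_nonneg (by positivity)]
    have := min_le_left w' m
    have := min_le_left w m
    have := (abs_le.1 h).2
    linarith
  rw [sq_sub_sq, abs_mul, mul_comm]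
  gcongr
  exact (abs_nonneg _).trans h

namespace IsAdjointLaw

lemma abs_gen_min_sq_le (hmu : ∀ i, 0 < mu i) (m : ℕ) {s : (Fin I → ℕ) × (Fin I → ℕ)}
    (hs : ∀ i, s.2 i ≤ s.1 i) (hn : ∀ i, s.2 i ≤ n) :
    |gen lam mu (fun x => min (work ell mu x) m ^ 2) s| ≤
      ∑ i, ((lam i : ℝ) + mu i * n) *
        ((ell i : ℝ) / mu i * (2 * work ell mu s.1 + (ell i : ℝ) / mu i)) := by
  refine (Finset.abs_sum_le_sum_abs _ _).trans (Finset.sum_le_sum fun i _ => ?_)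
  have hm := hmu i
  have hW := work_nonneg (ell := ell) hmu
  have ha : 0 ≤ (ell i : ℝ) / mu i := by positivity
  have hz : (s.2 i : ℝ) ≤ n := by exact_mod_cast hn i
  have h1 := abs_min_sq_sub_le (m := m) (hW s.1) (hW (s.1 + Pi.single i 1)) (by positivity)
    (a := (ell i : ℝ) / mu i) (by rw [work_add_single]; simp [abs_of_nonneg ha])
  have h2 : |mu i * s.2 i * (min (work ell mu (s.1 - Pi.single i 1)) m ^ 2 -
      min (work ell mu s.1) m ^ 2)| ≤ mu i * n *
        ((ell i : ℝ) / mu i * (2 * work ell mu s.1 + (ell i : ℝ) / mu i)) := by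
    have hW0 := hW s.1
    rcases Nat.eq_zero_or_pos (s.2 i) with h0 | h0
    · rw [h0]; simp; positivity
    · have := abs_min_sq_sub_le (m := m) (hW s.1) (hW (s.1 - Pi.single i 1)) (by positivity)
        (a := (ell i : ℝ) / mu i) (by
          rw [work_sub_single (lt_of_lt_of_le h0 (hs i))]; simp [abs_of_nonneg ha])
      rw [abs_mul, abs_of_nonneg (show 0 ≤ mu i * (s.2 i : ℝ) by positivity)]
      gcongr
  refine (abs_add_le _ _).trans ?_
  rw [abs_mul, abs_of_nonneg (lam i).coe_nonneg, add_mul]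
  gcongr

/-- The squared work has zero mean drift as soon as the work is integrable: truncate at level `m`,
apply the adjoint relation and let `m → ∞`. -/
lemma integral_gen_work_sq (h : IsAdjointLaw n lam ell mu π) (hmu : ∀ i, 0 < mu i)
    (hell : ∀ i, 0 < ell i) (hint : Integrable (fun s => work ell mu s.1) π) :
    ∫ s, gen lam mu (fun x => work ell mu x ^ 2) s ∂π = 0 := by
  have hp := h.prob
  refine integral_gen_eq_zero_of_tendsto (f := fun (m : ℕ) x => min (work ell mu x) m ^ 2)
    (fun x => ?_) (fun m => h.adjoint _ ((m : ℝ) ^ 2) fun x => ?_)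
    (B := fun s => ∑ i, ((lam i : ℝ) + mu i * n) *
        ((ell i : ℝ) / mu i * (2 * work ell mu s.1 + (ell i : ℝ) / mu i))) ?_ fun m => ?_
  · refine tendsto_const_nhds.congr' ?_
    filter_upwards [eventually_ge_atTop ⌈work ell mu x⌉₊] with m hm
    rw [min_eq_left ((Nat.le_ceil _).trans (by exact_mod_cast hm))]
  · have := work_nonneg (ell := ell) hmu x
    rw [abs_of_nonneg (by positivity)]
    gcongr
    exact min_le_right _ _
  · exact integrable_finsetSum _ fun i _ =>
      (((hint.const_mul 2).add (integrable_const _)).const_mul _).const_mul _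
  · filter_upwards [h.service_le, h.service_le_servers hell] with s h1 h2
    exact abs_gen_min_sq_le hmu m h1 h2

lemma integrable_idle (h : IsAdjointLaw n lam ell mu π) (hell : ∀ i, 0 < ell i) :
    Integrable (fun s => idle n ell s.2) π := by
  have := h.prob
  exact (integrable_const _).sub (integrable_finsetSum _ fun i _ =>
    (h.integrable_service hell i).const_mul _)

lemma integral_service_eq (h : IsAdjointLaw n lam ell mu π) (hmu : ∀ i, 0 < mu i)
    (hell : ∀ i, 0 < ell i) (i : Fin I) : ∫ s, (s.2 i : ℝ) ∂π = lam i / mu i := by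
  rw [eq_div_iff (hmu i).ne', mul_comm, h.integral_service hmu hell]

lemma integral_idle (h : IsAdjointLaw n lam ell mu π) (hmu : ∀ i, 0 < mu i)
    (hell : ∀ i, 0 < ell i) : ∫ s, idle n ell s.2 ∂π = slack n lam ell mu := by
  have := h.prob
  simp only [idle]
  rw [integral_sub (integrable_const _) (integrable_finsetSum _ fun i _ =>
    (h.integrable_service hell i).const_mul _), integral_finsetSum _ fun i _ =>
    (h.integrable_service hell i).const_mul _, slack]
  simp only [integral_const_mul, h.integral_service_eq hmu hell]
  simp [mul_div_assoc, mul_div_left_comm]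

lemma idle_mem (h : IsAdjointLaw n lam ell mu π) :
    ∀ᵐ s ∂π, 0 ≤ idle n ell s.2 ∧ idle n ell s.2 ≤ n := by
  filter_upwards [h.capacity] with s hs
  have h1 : ∑ i, (ell i : ℝ) * s.2 i ≤ n := by exact_mod_cast hs
  have h2 : 0 ≤ ∑ i, (ell i : ℝ) * s.2 i := Finset.sum_nonneg fun i _ => by positivity
  rw [idle]
  constructor <;> linarith

lemma integrable_work_mul_idle (h : IsAdjointLaw n lam ell mu π)
    (hint : Integrable (fun s => work ell mu s.1) π) :
    Integrable (fun s => work ell mu s.1 * idle n ell s.2) π := by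
  refine hint.mul_bdd (c := n) Measurable.of_discrete.aestronglyMeasurable ?_
  filter_upwards [h.idle_mem] with s hs
  rw [Real.norm_of_nonneg hs.1]
  exact hs.2

/-- The quadratic drift identity `δ E[W] = σ² + E[W U]`, with `W` the work and `U` the number of
idle servers. -/
lemma slack_mul_integral_work (h : IsAdjointLaw n lam ell mu π) (hmu : ∀ i, 0 < mu i)
    (hell : ∀ i, 0 < ell i) (hint : Integrable (fun s => work ell mu s.1) π) :
    slack n lam ell mu * ∫ s, work ell mu s.1 ∂π =
      workVar lam ell mu + ∫ s, work ell mu s.1 * idle n ell s.2 ∂π := by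
  have hp := h.prob
  have h0 := h.integral_gen_work_sq hmu hell hint
  have hWU := h.integrable_work_mul_idle hint
  have hi1 : Integrable (fun s : (Fin I → ℕ) × (Fin I → ℕ) => 2 *
      (work ell mu s.1 * (idle n ell s.2 - slack n lam ell mu))) π := by
    refine ((hWU.sub (hint.const_mul (slack n lam ell mu))).const_mul 2).congr
      (ae_of_all _ fun s => ?_)
    simp only [Pi.sub_apply]; ring
  have hi2 : ∀ i, Integrable (fun s : (Fin I → ℕ) × (Fin I → ℕ) =>
      ((ell i : ℝ) / mu i) ^ 2 * (lam i + mu i * s.2 i)) π := fun i =>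
    ((integrable_const _).add ((h.integrable_service hell i).const_mul _)).const_mul _
  have h1 : ∫ s, gen lam mu (fun x => work ell mu x ^ 2) s ∂π =
      ∫ s, (2 * (work ell mu s.1 * (idle n ell s.2 - slack n lam ell mu)) +
        ∑ i, ((ell i : ℝ) / mu i) ^ 2 * (lam i + mu i * s.2 i)) ∂π := by
    refine integral_congr_ae ?_
    filter_upwards [h.service_le] with s hs
    exact gen_work_sq hmu hs
  rw [h0, integral_add hi1 (integrable_finsetSum _ fun i _ => hi2 i),
    integral_finsetSum _ fun i _ => hi2 i, integral_const_mul] at h1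
  have h2 : ∫ s, work ell mu s.1 * (idle n ell s.2 - slack n lam ell mu) ∂π =
      (∫ s, work ell mu s.1 * idle n ell s.2 ∂π) -
        slack n lam ell mu * ∫ s, work ell mu s.1 ∂π := by
    rw [← integral_const_mul, ← integral_sub hWU (hint.const_mul _)]
    refine integral_congr_ae (ae_of_all _ fun s => ?_)
    simp only; ring
  have h3 : ∑ i, ∫ s : (Fin I → ℕ) × (Fin I → ℕ),
      ((ell i : ℝ) / mu i) ^ 2 * (lam i + mu i * s.2 i) ∂π = 2 * workVar lam ell mu := by
    rw [workVar, Finset.mul_sum]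
    refine Finset.sum_congr rfl fun i _ => ?_
    rw [integral_const_mul, integral_add (integrable_const _)
      ((h.integrable_service hell i).const_mul _), integral_const_mul,
      h.integral_service hmu hell]
    simp only [integral_const, probReal_univ, one_smul]
    rw [div_pow]; ring
  rw [h2, h3] at h1
  linarith

/-- The drift identity with the work centred at its mean in service turns into a lower bound for
the mean workload: idleness can only hurt the bound when some `xᵢ` is far below its offered load,
which is controlled by `yᵢ` and the lower-tail probabilities. -/
lemma le_slack_mul_integral_workload (h : IsAdjointLaw n lam ell mu π) (hmu : ∀ i, 0 < mu i)
    (hell : ∀ i, 0 < ell i) (hint : Integrable (workload ell mu) π) (y : Fin I → ℝ)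
    (hy : ∀ i, 0 ≤ y i) :
    workVar lam ell mu - slack n lam ell mu * ∑ i, (ell i : ℝ) / mu i * y i -
      n * ∑ i, (ell i : ℝ) / mu i * (lam i / mu i *
        π.real {s | (s.1 i : ℝ) + y i < lam i / mu i}) ≤
      slack n lam ell mu * ∫ s, workload ell mu s ∂π := by
  have hp := h.prob
  set c : ℝ := ∑ i, (ell i : ℝ) / mu i * (lam i / mu i) with hc
  have hZi : Integrable (fun s : (Fin I → ℕ) × (Fin I → ℕ) => work ell mu s.2) π :=
    integrable_finsetSum _ fun i _ => (h.integrable_service hell i).const_mul _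
  have hZ : ∫ s, work ell mu s.2 ∂π = c := by
    simp only [work]
    rw [integral_finsetSum _ fun i _ => (h.integrable_service hell i).const_mul _]
    simp only [integral_const_mul, h.integral_service_eq hmu hell, hc]
  have hsplit : ∀ s, workload ell mu s = work ell mu s.1 - work ell mu s.2 := fun s => by
    simp only [workload, work, ← Finset.sum_sub_distrib, mul_sub]
  have hW : Integrable (fun s => work ell mu s.1) π := by
    refine (hint.add hZi).congr (ae_of_all _ fun s => ?_)
    simp only [Pi.add_apply, hsplit]; ring
  have hQ : ∫ s, workload ell mu s ∂π = (∫ s, work ell mu s.1 ∂π) - c := by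
    rw [← hZ, ← integral_sub hW hZi]
    exact integral_congr_ae (ae_of_all _ hsplit)
  have hU := h.integrable_idle hell
  have hWU := h.integrable_work_mul_idle hW
  have hm : ∀ i, MeasurableSet {s : (Fin I → ℕ) × (Fin I → ℕ) |
    (s.1 i : ℝ) + y i < lam i / mu i} := fun i => MeasurableSet.of_discrete
  have hI : ∀ i, Integrable (fun s => (ell i : ℝ) / mu i * (lam i / mu i *
      {s : (Fin I → ℕ) × (Fin I → ℕ) | (s.1 i : ℝ) + y i < lam i / mu i}.indicator
        (fun _ => (1 : ℝ)) s)) π := fun i =>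
    ((Integrable.indicator (integrable_const _) (hm i)).const_mul _).const_mul _
  have hlow : ∫ s, (-(∑ i, (ell i : ℝ) / mu i * y i) * idle n ell s.2 -
      n * ∑ i, (ell i : ℝ) / mu i * (lam i / mu i *
        {s : (Fin I → ℕ) × (Fin I → ℕ) | (s.1 i : ℝ) + y i < lam i / mu i}.indicator
          (fun _ => (1 : ℝ)) s)) ∂π ≤
      ∫ s, (work ell mu s.1 * idle n ell s.2 - c * idle n ell s.2) ∂π := by
    refine integral_mono_ae ((hU.const_mul _).sub
      ((integrable_finsetSum _ fun i _ => hI i).const_mul _)) (hWU.sub (hU.const_mul _)) ?_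
    filter_upwards [h.idle_mem] with s hs
    set B : ℝ := ∑ i, (ell i : ℝ) / mu i * (lam i / mu i *
        {s : (Fin I → ℕ) × (Fin I → ℕ) | (s.1 i : ℝ) + y i < lam i / mu i}.indicator
          (fun _ => (1 : ℝ)) s) with hB
    have hB0 : 0 ≤ B := Finset.sum_nonneg fun i _ => by
      have := hmu i
      have : 0 ≤ {s : (Fin I → ℕ) × (Fin I → ℕ) | (s.1 i : ℝ) + y i < lam i / mu i}.indicator
          (fun _ => (1 : ℝ)) s := Set.indicator_nonneg (fun _ _ => zero_le_one) _
      positivity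
    have key : c - work ell mu s.1 ≤ (∑ i, (ell i : ℝ) / mu i * y i) + B := by
      rw [hc, work, hB, ← Finset.sum_sub_distrib, ← Finset.sum_add_distrib]
      refine Finset.sum_le_sum fun i _ => ?_
      rw [← mul_sub, ← mul_add]
      have := hmu i
      gcongr
      have hx : (0 : ℝ) ≤ s.1 i := Nat.cast_nonneg _
      have := hy i
      rw [Set.indicator_apply]
      split_ifs with hlt
      · linarith
      · rw [Set.mem_ofPred_eq, not_lt] at hlt
        linarith
    nlinarith [mul_le_mul_of_nonneg_right key hs.1, mul_le_mul_of_nonneg_left hs.2 hB0]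
  rw [integral_sub (hU.const_mul _)
      ((integrable_finsetSum _ fun i _ => hI i).const_mul _), integral_const_mul,
    integral_const_mul, integral_finsetSum _ fun i _ => hI i,
    integral_sub hWU (hU.const_mul _), integral_const_mul, h.integral_idle hmu hell] at hlow
  simp only [integral_const_mul, integral_indicator_const _ (hm _), smul_eq_mul, mul_one] at hlow
  have hD := h.slack_mul_integral_work hmu hell hW
  rw [hQ, mul_sub, hD]
  linarith

end IsAdjointLaw

/-! ### The error term -/

/-- What is lost from `σ²` in the lower bound for `δ E[workload]`: the deviations `2 √ρᵢ log n` of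
the numbers of jobs, weighted by the mean number `δ` of idle servers, and the contribution of larger
deviations. -/
noncomputable def loss (n : ℕ) (lam : Fin I → ℝ≥0) (ell : Fin I → ℕ) (mu : Fin I → ℝ) : ℝ :=
  slack n lam ell mu * ∑ i, (ell i : ℝ) / mu i * (2 * (√((lam i : ℝ) / mu i) * Real.log n)) +
    n * ∑ i, (ell i : ℝ) / mu i * (lam i / mu i *
      (((lam i : ℝ) / mu i + 1) * Real.exp (1 / 2 - Real.log n ^ 2)))

open Classical in
/-- The relative error `εₙ` of the lower bound; it is `1`, making the bound trivial, as long as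
`n` is too small for the estimates to apply. -/
noncomputable def relLoss (n : ℕ) (lam : Fin I → ℝ≥0) (ell : Fin I → ℕ) (mu : Fin I → ℝ) : ℝ :=
  if 0 < slack n lam ell mu ∧ 0 < workVar lam ell mu ∧ 1 ≤ Real.log n then
    loss n lam ell mu / workVar lam ell mu else 1

theorem IsAdjointLaw.le_lintegral_workload (h : IsAdjointLaw n lam ell mu π)
    (hmu : ∀ i, 0 < mu i) (hell : ∀ i, 0 < ell i) :
    ENNReal.ofReal (workVar lam ell mu / slack n lam ell mu * (1 - relLoss n lam ell mu)) ≤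
      ∫⁻ s, ENNReal.ofReal (workload ell mu s) ∂π := by
  rw [relLoss]
  split_ifs with hgood
  swap
  · simp
  obtain ⟨hδ, hσ, hL⟩ := hgood
  rcases eq_or_ne (∫⁻ s, ENNReal.ofReal (workload ell mu s) ∂π) ∞ with htop | hfin
  · rw [htop]; exact le_top
  have hp := h.prob
  have hnn : 0 ≤ᵐ[π] workload ell mu := by
    filter_upwards [h.service_le] with s hs
    refine Finset.sum_nonneg fun i _ => ?_
    have h1 := hmu i
    have h2 : (0 : ℝ) ≤ (s.1 i : ℝ) - s.2 i := sub_nonneg.2 (by exact_mod_cast hs i)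
    positivity
  have hint : Integrable (workload ell mu) π :=
    ⟨Measurable.of_discrete.aestronglyMeasurable,
      (hasFiniteIntegral_iff_ofReal hnn).2 (lt_top_iff_ne_top.2 hfin)⟩
  rw [← ofReal_integral_eq_lintegral_ofReal hint hnn]
  refine ENNReal.ofReal_le_ofReal ?_
  have hlog : 0 ≤ Real.log n := zero_le_one.trans hL
  have hmain := h.le_slack_mul_integral_workload hmu hell hint
    (fun i => 2 * (√((lam i : ℝ) / mu i) * Real.log n)) (fun i => by positivity)
  have htail : (n : ℝ) * ∑ i, (ell i : ℝ) / mu i * (lam i / mu i *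
      π.real {s | (s.1 i : ℝ) + 2 * (√((lam i : ℝ) / mu i) * Real.log n) < lam i / mu i}) ≤
      n * ∑ i, (ell i : ℝ) / mu i * (lam i / mu i *
        (((lam i : ℝ) / mu i + 1) * Real.exp (1 / 2 - Real.log n ^ 2))) := by
    gcongr with i _
    · have := hmu i; positivity
    · have := hmu i; positivity
    · exact h.measure_lower_tail_le hmu hell i hL
  have hle : workVar lam ell mu - loss n lam ell mu ≤
      slack n lam ell mu * ∫ s, workload ell mu s ∂π := by
    rw [loss]; linarith
  have e : workVar lam ell mu / slack n lam ell mu *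
      (1 - loss n lam ell mu / workVar lam ell mu) =
      (workVar lam ell mu - loss n lam ell mu) / slack n lam ell mu := by
    field_simp
  rw [e, div_le_iff₀ hδ, mul_comm _ (slack n lam ell mu)]
  exact hle

lemma need_mul_sqrt_load_le (hmu : ∀ i, 0 < mu i) (i : Fin I) :
    (ell i : ℝ) / mu i * √((lam i : ℝ) / mu i) ≤ √(workVar lam ell mu) * (1 / √(mu i)) := by
  have hm := hmu i
  have h1 : (lam i : ℝ) * (ell i : ℝ) ^ 2 / mu i ^ 2 ≤ workVar lam ell mu :=
    Finset.single_le_sum (f := fun i => (lam i : ℝ) * (ell i : ℝ) ^ 2 / mu i ^ 2)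
      (fun j _ => by have := hmu j; positivity) (Finset.mem_univ i)
  have h2 : (ell i : ℝ) / mu i = √(((ell i : ℝ) / mu i) ^ 2) :=
    (Real.sqrt_sq (by positivity)).symm
  rw [h2, ← Real.sqrt_mul (by positivity), mul_one_div, ← Real.sqrt_div' _ hm.le]
  apply Real.sqrt_le_sqrt
  calc _ = (lam i : ℝ) * (ell i : ℝ) ^ 2 / mu i ^ 2 / mu i := by field_simp
    _ ≤ _ := by gcongr

/-- An explicit bound on the relative loss, in terms of the heavy-traffic ratio `δ log n / σ`. -/
lemma loss_div_le (hmu : ∀ i, 0 < mu i) (hell : ∀ i, 0 < ell i)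
    (hδ : 0 ≤ slack n lam ell mu) (hσ : 1 ≤ workVar lam ell mu) (hL : 4 ≤ Real.log n) :
    loss n lam ell mu / workVar lam ell mu ≤
      2 * (∑ i, 1 / √(mu i)) * (slack n lam ell mu / (√(workVar lam ell mu) / Real.log n)) +
        2 * Real.exp (1 / 2) * (∑ i, 1 / mu i) / n := by
  have hn : (0 : ℝ) < n := by
    rcases Nat.eq_zero_or_pos n with h0 | h0
    · subst h0; norm_num at hL
    · exact_mod_cast h0
  have hσ0 : 0 < workVar lam ell mu := lt_of_lt_of_le one_pos hσ
  have hs0 : 0 < √(workVar lam ell mu) := Real.sqrt_pos.2 hσ0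
  have hsq : √(workVar lam ell mu) * √(workVar lam ell mu) = workVar lam ell mu :=
    Real.mul_self_sqrt hσ0.le
  have hL0 : 0 < Real.log n := by linarith
  rw [loss, add_div]
  refine add_le_add ?_ ?_
  · calc _ ≤ slack n lam ell mu * (∑ i, 2 * (√(workVar lam ell mu) * (1 / √(mu i))) *
          Real.log n) / workVar lam ell mu := by
          refine div_le_div_of_nonneg_right (mul_le_mul_of_nonneg_left
            (Finset.sum_le_sum fun i _ => ?_) hδ) hσ0.le
          have := need_mul_sqrt_load_le (lam := lam) (ell := ell) hmu i
          calc _ = 2 * ((ell i : ℝ) / mu i * √((lam i : ℝ) / mu i)) * Real.log n := by ring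
            _ ≤ _ := by gcongr
      _ = slack n lam ell mu * (2 * √(workVar lam ell mu) * (∑ i, 1 / √(mu i)) * Real.log n) /
          (√(workVar lam ell mu) * √(workVar lam ell mu)) := by
          rw [hsq, ← Finset.sum_mul, Finset.mul_sum]
          simp only [mul_assoc]
      _ = _ := by field_simp
  · have hterm : ∀ i, (lam i : ℝ) * ell i / mu i ≤ n := fun i => by
      have h1 : (lam i : ℝ) * ell i / mu i ≤ ∑ i, (lam i : ℝ) * ell i / mu i :=
        Finset.single_le_sum (f := fun i => (lam i : ℝ) * ell i / mu i)
          (fun j _ => by have := hmu j; positivity) (Finset.mem_univ i)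
      rw [slack] at hδ
      linarith
    have hρ : ∀ i, (lam i : ℝ) / mu i ≤ n := fun i => by
      refine le_trans ?_ (hterm i)
      have h1 : (1 : ℝ) ≤ ell i := by exact_mod_cast hell i
      have := hmu i
      rw [mul_div_right_comm]
      exact le_mul_of_one_le_right (by positivity) h1
    have hexp : Real.exp (1 / 2 - Real.log n ^ 2) ≤ Real.exp (1 / 2) / n ^ 4 := by
      rw [Real.exp_sub]
      gcongr
      calc (n : ℝ) ^ 4 = Real.exp (4 * Real.log n) := by
            rw [mul_comm, Real.exp_mul, Real.exp_log hn]; norm_cast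
        _ ≤ _ := Real.exp_le_exp.2 (by nlinarith)
    have hn1 : (1 : ℝ) ≤ n := by exact_mod_cast (Nat.cast_pos.1 hn : 0 < n)
    calc _ ≤ (n : ℝ) * ∑ i, (ell i : ℝ) / mu i * (lam i / mu i *
          (((lam i : ℝ) / mu i + 1) * Real.exp (1 / 2 - Real.log n ^ 2))) := by
          refine div_le_self (mul_nonneg hn.le (Finset.sum_nonneg fun i _ => ?_)) hσ
          have := hmu i
          positivity
      _ ≤ n * ∑ i, n * (1 / mu i) * ((n + n) * (Real.exp (1 / 2) / n ^ 4)) := by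
          refine mul_le_mul_of_nonneg_left (Finset.sum_le_sum fun i _ => ?_) hn.le
          have := hmu i
          calc _ = (lam i : ℝ) * ell i / mu i * (1 / mu i) *
              (((lam i : ℝ) / mu i + 1) * Real.exp (1 / 2 - Real.log n ^ 2)) := by
                field_simp
            _ ≤ _ := by
                refine mul_le_mul (mul_le_mul_of_nonneg_right (hterm i) (by positivity)) ?_
                  (by positivity) (by positivity)
                refine mul_le_mul (add_le_add (hρ i) hn1) hexp (by positivity) (by positivity)
      _ = _ := by
          rw [← Finset.sum_mul, ← Finset.mul_sum]
          field_simp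
          ring

lemma relLoss_nonneg (hmu : ∀ i, 0 < mu i) : 0 ≤ relLoss n lam ell mu := by
  rw [relLoss]
  split_ifs with h
  · obtain ⟨h1, h2, h3⟩ := h
    rw [loss]
    have h4 : ∀ i, 0 ≤ (ell i : ℝ) / mu i * (2 * (√((lam i : ℝ) / mu i) * Real.log n)) :=
      fun i => by have := hmu i; positivity
    have h5 : ∀ i, 0 ≤ (ell i : ℝ) / mu i * (lam i / mu i *
      (((lam i : ℝ) / mu i + 1) * Real.exp (1 / 2 - Real.log n ^ 2))) :=
      fun i => by have := hmu i; positivity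
    have h6 := Finset.sum_nonneg fun i (_ : i ∈ Finset.univ) => h4 i
    have h7 := Finset.sum_nonneg fun i (_ : i ∈ Finset.univ) => h5 i
    positivity
  · exact zero_le_one

theorem tendsto_relLoss {mu : Fin I → ℝ} (hmu : ∀ i, 0 < mu i)
    {lam : ℕ → Fin I → ℝ≥0} {ell : ℕ → Fin I → ℕ} (hell : ∀ n i, 0 < ell n i)
    (hTraffic : (fun n : ℕ => slack n (lam n) (ell n) mu) =o[atTop]
      fun n : ℕ => √(workVar (lam n) (ell n) mu) / Real.log n)
    (hNeed : ∃ ε₀ : ℝ, 0 < ε₀ ∧ ε₀ < 1 ∧ ∀ᶠ n : ℕ in atTop,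
      (maxNeed (ell n) : ℝ) ≤ ε₀ * slack n (lam n) (ell n) mu) :
    Tendsto (fun n => relLoss n (lam n) (ell n) mu) atTop (𝓝 0) := by
  obtain ⟨ε₀, hε0, hε1, hNeed⟩ := hNeed
  have hδ1 : ∀ᶠ n : ℕ in atTop, 1 ≤ slack n (lam n) (ell n) mu := by
    filter_upwards [hNeed, eventually_ge_atTop 1] with n hn hn1
    rcases Nat.eq_zero_or_pos I with hI | hI
    -- without job types all servers are idle
    · subst hI
      simpa [slack] using hn1
    · have h1 : 1 ≤ maxNeed (ell n) :=
        (hell n ⟨0, hI⟩).trans_le (Finset.le_sup (f := ell n) (Finset.mem_univ _))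
      have h2 : (1 : ℝ) ≤ maxNeed (ell n) := by exact_mod_cast h1
      nlinarith
  have hlog : ∀ᶠ n : ℕ in atTop, 4 ≤ Real.log n :=
    (Real.tendsto_log_atTop.comp tendsto_natCast_atTop_atTop).eventually_ge_atTop 4
  have hσ1 : ∀ᶠ n : ℕ in atTop, 1 ≤ workVar (lam n) (ell n) mu := by
    filter_upwards [hδ1, hlog, hTraffic.def one_pos] with n h1 h2 h3
    rw [one_mul, Real.norm_of_nonneg (by linarith), Real.norm_of_nonneg (by positivity),
      le_div_iff₀ (by linarith)] at h3
    have h4 : 1 ≤ √(workVar (lam n) (ell n) mu) := by nlinarith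
    rwa [Real.one_le_sqrt] at h4
  have hratio := hTraffic.tendsto_div_nhds_zero
  have hbound : Tendsto (fun n : ℕ => 2 * (∑ i, 1 / √(mu i)) *
      (slack n (lam n) (ell n) mu / (√(workVar (lam n) (ell n) mu) / Real.log n)) +
        2 * Real.exp (1 / 2) * (∑ i, 1 / mu i) / n) atTop (𝓝 0) := by
    simpa using (hratio.const_mul (2 * ∑ i, 1 / √(mu i))).add
      (tendsto_const_div_atTop_nhds_zero_nat (2 * Real.exp (1 / 2) * ∑ i, 1 / mu i))
  refine squeeze_zero' (Eventually.of_forall fun n => relLoss_nonneg hmu) ?_ hbound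
  filter_upwards [hδ1, hσ1, hlog] with n h1 h2 h3
  rw [relLoss, if_pos ⟨by linarith, by linarith, by linarith⟩]
  exact loss_div_le hmu (hell n) (by linarith) h2 h3

end MultiserverJob

theorem lemma1 (I : ℕ) (mu : Fin I → ℝ) (hmu : ∀ i, 0 < mu i)
    (lam : ℕ → Fin I → ℝ≥0) (ell : ℕ → Fin I → ℕ) (hell : ∀ n i, 0 < ell n i)
    (hTraffic : (fun n : ℕ => MultiserverJob.slack n (lam n) (ell n) mu) =o[atTop]
      fun n : ℕ => √(MultiserverJob.workVar (lam n) (ell n) mu) / Real.log n)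
    (hNeed : ∃ ε₀ : ℝ, 0 < ε₀ ∧ ε₀ < 1 ∧ ∀ᶠ n : ℕ in atTop,
      (MultiserverJob.maxNeed (ell n) : ℝ) ≤ ε₀ * MultiserverJob.slack n (lam n) (ell n) mu) :
    ∃ ε : ℕ → ℝ, Tendsto ε atTop (𝓝 0) ∧
      ∀ (n : ℕ) {Ω : Type*} {mΩ : MeasurableSpace Ω} (P : Measure Ω) [IsProbabilityMeasure P]
        (ℱ : Filtration ℝ≥0 mΩ) (X Z A D : ℝ≥0 → Ω → Fin I → ℕ)
        (π : Measure ((Fin I → ℕ) × (Fin I → ℕ))),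
        MultiserverJob.IsProcess n (lam n) (ell n) mu P ℱ X Z A D →
        MultiserverJob.IsSteadyState P X Z π →
        ENNReal.ofReal (MultiserverJob.workVar (lam n) (ell n) mu /
            MultiserverJob.slack n (lam n) (ell n) mu * (1 - ε n)) ≤
          ∫⁻ s, ENNReal.ofReal (MultiserverJob.workload (ell n) mu s) ∂π := by
  refine ⟨fun n => MultiserverJob.relLoss n (lam n) (ell n) mu,
    MultiserverJob.tendsto_relLoss hmu hell hTraffic hNeed, ?_⟩
  intro n Ω mΩ P _ ℱ X Z A D π h hπ
  exact (hπ.isAdjointLaw h hmu (hell n)).le_lintegral_workload hmu (hell n)
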